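/- Let $\mathbb{F}$ be a field and let $\mathbb{F}\langle X\rangle$ be the ring of polynomials over $\mathbb{F}$ in the noncommuting variables $X=\{x_1,\dots,x_n\}$, $n\ge 1$. For $f\in\mathbb{F}\langle X\rangle$ let $f^{(i)}$ be its homogeneous part of degree $i$. Let $H=\{h_1,\dots,h_m\}\subseteq\mathbb{F}\langle X\rangle$, $m\ge 1$ (the help polynomials, not necessarily homogeneous). An algebraic branching program (ABP) using $H$ is a directed acyclic graph with a source $s$ and a sink $t$ in which every edge $e$ is labeled by a linear form $\sum_i\alpha_i x_i+\sum_j\beta_j y_j$ over $\mathbb{F}$; the polynomial associated with $e$ is $L'(e)=\sum_i\alpha_i x_i+\sum_j\beta_j h_j$. The ABP computes the polynomial $\sum_{\gamma} L'(e_1)L'(e_2)\cdots L'(e_l)$, where $\gamma=(e_1,\dots,e_l)$ ranges over all paths from $s$ to $t$. Its size is its number of vertices. Fix a constant $\varepsilon$ with $0<\varepsilon\le 1$. Let $d\ge 2$ be even, and suppose that every nonzero homogeneous part $h_j^{(i)}$ with $1\le j\le m$ and $i\ge 2$ has degree $i\ge(\frac12+\varepsilon)d$. Then there is an explicit nonzero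 homogeneous polynomial $F\in\mathbb{F}\langle X\rangle$ of degree $d$ such that every ABP computing $F$ using $H$ has size at least $$\frac{1}{d+1}\left\lfloor\frac{n^{\varepsilon d/2}}{2md^2}\right\rfloor .$$ Here "explicit" means the following. There is an algorithm, depending only on $\mathbb{F}$ and $\varepsilon$, which for all such $n,m,d,H$, given $n,m,D,d$ and the coefficients of $h_1,\dots,h_m$ at all monomials of degree at most $D=\max_j\deg h_j$, writes down the coefficients of $F$ at all monomials of degree at most $d$, in time polynomial in the number of coefficients of the input and the output, that is, in $m\sum_{i=0}^{D}n^i+\sum_{i=0}^{d}n^i$. Time is counted on a random access machine on which arithmetic operations and zero tests in $\mathbb{F}$ have unit cost, while operations on natural numbers and memory accesses are charged the values of the numbers and addresses involved. -/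

import Mathlib

noncomputable section

namespace NCABP

open scoped Classical

/-! ### Noncommutative polynomials -/

/-- The ring `K⟨x_0, …, x_{n-1}⟩` of polynomials in `n` noncommuting variables. Its monomials are the
words over `Fin n`, and `f.coeff w` is the coefficient of the monomial `w` in `f`. -/
abbrev NCPoly (K : Type*) [Field K] (n : ℕ) : Type _ := MonoidAlgebra K (FreeMonoid (Fin n))

/-- The variable `x_i`. -/
def ncVar (K : Type*) [Field K] {n : ℕ} (i : Fin n) : NCPoly K n :=
  MonoidAlgebra.single (FreeMonoid.of i) 1

/-- The degree of a noncommutative polynomial (`0` for the zero polynomial). -/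
def degree {K : Type*} [Field K] {n : ℕ} (f : NCPoly K n) : ℕ :=
  f.coeff.support.sup FreeMonoid.length

/-- All monomials of `f` have degree `d`. -/
def IsHomogeneousOfDegree {K : Type*} [Field K] {n : ℕ} (f : NCPoly K n) (d : ℕ) : Prop :=
  ∀ w : FreeMonoid (Fin n), f.coeff w ≠ 0 → w.length = d

/-- The `i`-th homogeneous part of `f`. -/
def homogeneousPart {K : Type*} [Field K] {n : ℕ} (i : ℕ) (f : NCPoly K n) : NCPoly K n :=
  MonoidAlgebra.ofCoeff (f.coeff.filter fun w => w.length = i)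

/-- The set of all (nonzero) homogeneous parts of degree at least `2` of the polynomials
`h_0, …, h_{m-1}`. -/
def highParts {K : Type*} [Field K] {n m : ℕ} (h : Fin m → NCPoly K n) : Set (NCPoly K n) :=
  {g | g ≠ 0 ∧ ∃ (j : Fin m) (i : ℕ), 2 ≤ i ∧ g = homogeneousPart i (h j)}

/-! ### Algebraic branching programs with help polynomials -/

/-- An algebraic branching program over `K` with variables `x_0, …, x_{n-1}` and with `m` further
variables `y_0, …, y_{m-1}`, which stand for the help polynomials. Its vertices are
`0, …, size - 1`. Every vertex lies on a layer and all edges go from a layer to a later one (not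
necessarily the next one), so these are exactly the directed acyclic graphs; programs all of whose
edges join consecutive layers are a special case.
The edge `(u, v)` has the label `∑ i, xCoeff (u, v) i • x_i + ∑ j, yCoeff (u, v) j • y_j`. -/
structure ABP (K : Type*) [Field K] (n m : ℕ) where
  size : ℕ
  source : Fin size
  sink : Fin size
  edges : Finset (Fin size × Fin size)
  layer : Fin size → ℕ
  layer_lt : ∀ e ∈ edges, layer e.1 < layer e.2
  xCoeff : Fin size × Fin size → Fin n → K
  yCoeff : Fin size × Fin size → Fin m → K

namespace ABP

variable {K : Type*} [Field K] {n m : ℕ}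

/-- The polynomial associated with an edge: its label, with `h_j` substituted for `y_j`. -/
def edgePoly (A : ABP K n m) (h : Fin m → NCPoly K n) (e : Fin A.size × Fin A.size) : NCPoly K n :=
  ∑ i, A.xCoeff e i • ncVar K i + ∑ j, A.yCoeff e j • h j

/-- `A.IsPath u v p`: the list of edges `p` is a path from `u` to `v`. -/
def IsPath (A : ABP K n m) : Fin A.size → Fin A.size → List (Fin A.size × Fin A.size) → Prop
  | u, v, [] => u = v
  | u, v, e :: p => e ∈ A.edges ∧ e.1 = u ∧ A.IsPath e.2 v p

/-- The product, in order, of the polynomials associated with the edges of a path. -/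
def pathPoly (A : ABP K n m) (h : Fin m → NCPoly K n) (p : List (Fin A.size × Fin A.size)) :
    NCPoly K n :=
  (p.map (A.edgePoly h)).prod

theorem IsPath.length_add_layer_le (A : ABP K n m) {u v : Fin A.size}
    {p : List (Fin A.size × Fin A.size)} (hp : A.IsPath u v p) :
    p.length + A.layer u ≤ A.layer v := by
  induction p generalizing u with
  | nil =>
    have huv : u = v := hp
    simp [huv]
  | cons e p ih =>
    obtain ⟨he, hu, hp⟩ := hp
    have h1 := A.layer_lt e he
    have h2 := ih hp
    rw [hu] at h1
    simp only [List.length_cons]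
    omega

/-- There are only finitely many paths from `u` to `v`. -/
theorem finite_setOf_isPath (A : ABP K n m) (u v : Fin A.size) : {p | A.IsPath u v p}.Finite :=
  (List.finite_length_le _ (A.layer v)).subset fun p hp => by
    have := IsPath.length_add_layer_le A hp
    simp only [Set.mem_ofPred_eq]
    omega

/-- The polynomial `f_{u,v}`: the sum over all paths from `u` to `v` of their polynomials. -/
def polyBetween (A : ABP K n m) (h : Fin m → NCPoly K n) (u v : Fin A.size) : NCPoly K n :=
  ∑ p ∈ (A.finite_setOf_isPath u v).toFinset, A.pathPoly h p

/-- `A` computes `f` using the help polynomials `h`. -/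
def Computes (A : ABP K n m) (h : Fin m → NCPoly K n) (f : NCPoly K n) : Prop :=
  A.polyBetween h A.source A.sink = f

end ABP

/-! ### Algebraic random access programs with a step count

A program works on natural number variables, arrays of natural numbers and arrays of field elements.
Arithmetic operations in `K` and tests for zero in `K` have unit cost. Every operation on natural
numbers is charged the values of its arguments and of its result, and every memory access is charged
the value of the address, so that the natural numbers give no more than what an ordinary
random access machine with logarithmic costs can do. Programs have no field constants
but `0` and `1`, and no way of knowing the size of their input but by reading it. -/

/-- Expressions with natural numbers as values; `sub` is truncated, `div` and `mod` are the usual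
quotient and remainder. -/
inductive NExpr : Type
  | const (c : ℕ)
  | var (x : ℕ)
  | get (a : ℕ) (i : NExpr)
  | add (e₁ e₂ : NExpr)
  | sub (e₁ e₂ : NExpr)
  | mul (e₁ e₂ : NExpr)
  | div (e₁ e₂ : NExpr)
  | mod (e₁ e₂ : NExpr)

/-- Expressions with field elements as values. -/
inductive FExpr : Type
  | zero
  | one
  | get (a : ℕ) (i : NExpr)
  | add (e₁ e₂ : FExpr)
  | sub (e₁ e₂ : FExpr)
  | mul (e₁ e₂ : FExpr)
  | inv (e : FExpr)

/-- Programs. -/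
inductive Prog : Type
  /-- do nothing -/
  | skip
  /-- `c₁; c₂` -/
  | seq (c₁ c₂ : Prog)
  /-- `x := e` for the natural number variable `x` -/
  | setVar (x : ℕ) (e : NExpr)
  /-- `a[i] := e` for the array `a` of natural numbers -/
  | setNat (a : ℕ) (i e : NExpr)
  /-- `a[i] := e` for the array `a` of field elements -/
  | setField (a : ℕ) (i : NExpr) (e : FExpr)
  /-- `if e₁ < e₂ then c₁ else c₂` -/
  | ifLt (e₁ e₂ : NExpr) (c₁ c₂ : Prog)
  /-- `if e = 0 then c₁ else c₂` -/
  | ifZero (e : FExpr) (c₁ c₂ : Prog)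
  /-- `for x = 0, 1, …, e - 1 do c`, where `e` is evaluated once, at the start -/
  | loop (x : ℕ) (e : NExpr) (c : Prog)

/-- The memory of a program. -/
@[ext] structure State (K : Type*) where
  /-- the natural number variables -/
  var : ℕ → ℕ
  /-- the arrays of natural numbers: `nat a i` is the `i`-th entry of the array `a` -/
  nat : ℕ → ℕ → ℕ
  /-- the arrays of field elements: `field a i` is the `i`-th entry of the array `a` -/
  field : ℕ → ℕ → K

section Semantics

variable {K : Type*} [Field K]

def NExpr.eval (s : State K) : NExpr → ℕ
  | .const c => c
  | .var x => s.var x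
  | .get a i => s.nat a (i.eval s)
  | .add e₁ e₂ => e₁.eval s + e₂.eval s
  | .sub e₁ e₂ => e₁.eval s - e₂.eval s
  | .mul e₁ e₂ => e₁.eval s * e₂.eval s
  | .div e₁ e₂ => e₁.eval s / e₂.eval s
  | .mod e₁ e₂ => e₁.eval s % e₂.eval s

/-- The cost of an expression: one for each node, and the value of each node. -/
def NExpr.cost (s : State K) : NExpr → ℕ
  | .const c => 1 + c
  | .var x => 1 + s.var x
  | .get a i => 1 + i.cost s + (NExpr.get a i).eval s
  | .add e₁ e₂ => 1 + e₁.cost s + e₂.cost s + (NExpr.add e₁ e₂).eval s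
  | .sub e₁ e₂ => 1 + e₁.cost s + e₂.cost s + (NExpr.sub e₁ e₂).eval s
  | .mul e₁ e₂ => 1 + e₁.cost s + e₂.cost s + (NExpr.mul e₁ e₂).eval s
  | .div e₁ e₂ => 1 + e₁.cost s + e₂.cost s + (NExpr.div e₁ e₂).eval s
  | .mod e₁ e₂ => 1 + e₁.cost s + e₂.cost s + (NExpr.mod e₁ e₂).eval s

def FExpr.eval (s : State K) : FExpr → K
  | .zero => 0
  | .one => 1
  | .get a i => s.field a (i.eval s)
  | .add e₁ e₂ => e₁.eval s + e₂.eval s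
  | .sub e₁ e₂ => e₁.eval s - e₂.eval s
  | .mul e₁ e₂ => e₁.eval s * e₂.eval s
  | .inv e => (e.eval s)⁻¹

def FExpr.cost (s : State K) : FExpr → ℕ
  | .zero => 1
  | .one => 1
  | .get _ i => 1 + i.cost s
  | .add e₁ e₂ => 1 + e₁.cost s + e₂.cost s
  | .sub e₁ e₂ => 1 + e₁.cost s + e₂.cost s
  | .mul e₁ e₂ => 1 + e₁.cost s + e₂.cost s
  | .inv e => 1 + e.cost s

def State.setVar (s : State K) (x v : ℕ) : State K :=
  { s with var := Function.update s.var x v }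

def State.setNat (s : State K) (a i v : ℕ) : State K :=
  { s with nat := Function.update s.nat a (Function.update (s.nat a) i v) }

def State.setField (s : State K) (a i : ℕ) (v : K) : State K :=
  { s with field := Function.update s.field a (Function.update (s.field a) i v) }

/-- The state after `k` rounds of a loop with loop variable `x` and body `body`. -/
def iterate (x : ℕ) (body : State K → State K) (s : State K) : ℕ → State K
  | 0 => s
  | k + 1 => body ((iterate x body s k).setVar x k)

/-- The memory after the run of a program. -/
def Prog.run : Prog → State K → State K
  | .skip, s => s
  | .seq c₁ c₂, s => c₂.run (c₁.run s)
  | .setVar x e, s => s.setVar x (e.eval s)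
  | .setNat a i e, s => s.setNat a (i.eval s) (e.eval s)
  | .setField a i e, s => s.setField a (i.eval s) (e.eval s)
  | .ifLt e₁ e₂ c₁ c₂, s => if e₁.eval s < e₂.eval s then c₁.run s else c₂.run s
  | .ifZero e c₁ c₂, s => if e.eval s = 0 then c₁.run s else c₂.run s
  | .loop x e c, s => iterate x c.run s (e.eval s)

/-- The running time of a program. -/
def Prog.time : Prog → State K → ℕ
  | .skip, _ => 1
  | .seq c₁ c₂, s => c₁.time s + c₂.time (c₁.run s)
  | .setVar _ e, s => 1 + e.cost s
  | .setNat _ i e, s => 1 + i.cost s + e.cost s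
  | .setField _ i e, s => 1 + i.cost s + e.cost s
  | .ifLt e₁ e₂ c₁ c₂, s =>
    1 + e₁.cost s + e₂.cost s + if e₁.eval s < e₂.eval s then c₁.time s else c₂.time s
  | .ifZero e c₁ c₂, s => 1 + e.cost s + if e.eval s = 0 then c₁.time s else c₂.time s
  | .loop x e c, s =>
    1 + e.cost s +
      ∑ k ∈ Finset.range (e.eval s), (1 + k + c.time ((iterate x c.run s k).setVar x k))

end Semantics

/-! ### Input and output of coefficients -/

/-- The number of monomials of degree at most `D` in `n` noncommuting variables. -/
def numMonomials (n D : ℕ) : ℕ := ∑ i ∈ Finset.range (D + 1), n ^ i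

/-- The position of a word in the list of all words over `Fin n`, ordered by length and
lexicographically for each length. The words of length at most `D` have the positions
`0, …, numMonomials n D - 1`. -/
def position {n : ℕ} (w : FreeMonoid (Fin n)) : ℕ :=
  w.toList.foldl (fun q a => n * q + (a : ℕ) + 1) 0

/-- The coefficient in `f` of the word at position `q`. -/
def coeffAt {K : Type*} [Field K] {n : ℕ} (f : NCPoly K n) (q : ℕ) : K :=
  ∑ w ∈ f.coeff.support with position w = q, f.coeff w

/-- The largest degree of a help polynomial. -/
def helpDegree {K : Type*} [Field K] {n m : ℕ} (h : Fin m → NCPoly K n) : ℕ :=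
  Finset.univ.sup fun j => degree (h j)

/-- The initial memory of a program that is given the polynomials `h_0, …, h_{m-1}` and
the number `d`. The first four variables hold `n`, `m`, the largest degree `D` of the `h_j`, and `d`.
The field array `0` holds the coefficients of all monomials of degree at most `D` in `h_0`, then those
in `h_1`, and so on. All other memory is zero. -/
def inputState {K : Type*} [Field K] {n m : ℕ} (h : Fin m → NCPoly K n) (d : ℕ) : State K where
  var x := if x = 0 then n else if x = 1 then m else if x = 2 then helpDegree h
    else if x = 3 then d else 0
  nat _ _ := 0
  field a q :=
    if a = 0 then
      if hq : q / numMonomials n (helpDegree h) < m then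
        coeffAt (h ⟨q / numMonomials n (helpDegree h), hq⟩) (q % numMonomials n (helpDegree h))
      else 0
    else 0

/-- The total number of coefficients of the input (the polynomials `h_j`, of degree at most `D`)
and of the output (a polynomial of degree at most `d`). -/
def numCoeffs {K : Type*} [Field K] {n m : ℕ} (h : Fin m → NCPoly K n) (d : ℕ) : ℕ :=
  m * numMonomials n (helpDegree h) + numMonomials n d

/-- On the input `h`, `d` the program `P` writes the coefficients of all monomials of degree at
most `d` in `F` into the field array `1`. -/
def Prog.Writes {K : Type*} [Field K] {n m : ℕ} (P : Prog) (h : Fin m → NCPoly K n) (d : ℕ)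
    (F : NCPoly K n) : Prop :=
  ∀ w : FreeMonoid (Fin n), w.length ≤ d → (P.run (inputState h d)).field 1 (position w) = F.coeff w

end NCABP

end

/-! Read the coefficients of `F` in degree `d` as an `N × N` matrix with `N = n ^ (d / 2)`: rows are
the first halves of words, columns the second halves. The column of `q` is the degree-`d / 2` part
of the right quotient of `F` by `q`, the polynomial with coefficient `F.coeff (w * q)` at `w`.

Suppose an ABP with fewer than `r` vertices computes `F`. Linear algebra gives scalars `c q`, not
all zero, for the first `r` columns such that `∑ c q • coeff q` vanishes on the polynomial from `v`
to the sink for every vertex `v`. Induction from the sink backwards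
(`sum_smul_rightQuot_polyBetween_mem`) then places `∑ c q • rightQuot q F` in the left ideal
generated by the quotients of the `h j` by nonempty prefixes of the words `q` involved, with
constant terms dropped. Only homogeneous parts of degree at least `2` survive in these generators,
so the parts of degree `0` and `1` are unrestricted.

In degree `d / 2` this ideal is small. A generator for a prefix `a₀`, multiplied on the left by a
monomial `a` of length `k < d / 2`, yields a vector (`genVec`) that reads `h j` in degree `d / 2 - k
+ a₀.length ≤ d - k`. By the degree gap the vector is zero unless `k ≤ d / 2 - ε * d`. Each column
therefore contributes at most `δ`, about `(d / 2) ^ 2 * m * n ^ (d / 2 - ε * d)`, nonzero vectors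
(`genCount_le`).

It suffices that each of the first `r` columns lies outside the span of the earlier columns and of
the vectors `genVec` for all columns up to its own: the largest index in the relation then gives a
contradiction (`le_size`). Such columns exist as long as `r * (δ + 1) ≤ N`, and they can be found
greedily: in an echelon basis of the span so far, the indicator of the positions without pivot is
outside the span (`Echelon.indicator_notMem`). This is incremental Gaussian elimination on vectors
of length `N`, and it makes `F` explicit.

The remaining work is to write this as a program, prove it correct (`mainProg_run`) and bound its
time (`whole_time`). Apart from tables of powers and offsets, the program computes no natural
numbers other than loop variables, so its cost is polynomial for structural reasons. The argument
gives the size bound `r` itself; the factor `1 / (d + 1)` is slack. -/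

noncomputable section

namespace NCABP

open scoped Classical

/-! ### Incremental Gaussian elimination -/

section Echelon

variable {K : Type*} [Field K]

/-- The rows of `B` that are in use: those with a nonzero diagonal entry. -/
def pivots (N : ℕ) (B : ℕ → ℕ → K) : Finset ℕ := (Finset.range N).filter fun p => B p p ≠ 0

/-- The span of the rows of `B` that are in use. -/
def rowSpan (N : ℕ) (B : ℕ → ℕ → K) : Submodule K (ℕ → K) :=
  Submodule.span K (B '' (pivots N B : Set ℕ))

/-- The rows of `B` that are in use have their leading entry on the diagonal. -/
def Echelon (N : ℕ) (B : ℕ → ℕ → K) : Prop := ∀ p ∈ pivots N B, ∀ c < p, B p c = 0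

theorem mem_pivots {N : ℕ} {B : ℕ → ℕ → K} {p : ℕ} : p ∈ pivots N B ↔ p < N ∧ B p p ≠ 0 := by
  simp [pivots]

theorem row_mem_rowSpan {N : ℕ} {B : ℕ → ℕ → K} {p : ℕ} (hp : p ∈ pivots N B) :
    B p ∈ rowSpan N B :=
  Submodule.subset_span ⟨p, hp, rfl⟩

/-- A vector in the row span that vanishes at all pivots is zero. -/
theorem Echelon.eq_zero {N : ℕ} {B : ℕ → ℕ → K} (hB : Echelon N B) {x : ℕ → K}
    (hx : x ∈ rowSpan N B) (h0 : ∀ p ∈ pivots N B, x p = 0) : x = 0 := by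
  obtain ⟨a, ha⟩ : ∃ a : ℕ → K, ∑ p ∈ pivots N B, a p • B p = x := by
    exact (Submodule.mem_span_image_finset_iff_exists_fun' K).1 hx
  by_cases hz : ∀ p ∈ pivots N B, a p = 0
  · rw [← ha]
    exact Finset.sum_eq_zero fun p hp => by rw [hz p hp, zero_smul]
  · exfalso
    push Not at hz
    have hne : ((pivots N B).filter fun p => a p ≠ 0).Nonempty := by
      obtain ⟨p, hp, hap⟩ := hz
      exact ⟨p, by simp [hp, hap]⟩
    -- At the least index `p` with a nonzero coefficient, earlier rows have coefficient zero and
    -- later rows vanish in position `p` by the echelon form, so `x p = a p * B p p ≠ 0`.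
    set p := ((pivots N B).filter fun p => a p ≠ 0).min' hne with hpdef
    have hmem := Finset.min'_mem _ hne
    rw [← hpdef, Finset.mem_filter] at hmem
    have h1 := h0 p hmem.1
    rw [← ha, Finset.sum_apply, Finset.sum_eq_single p] at h1
    · have := (mem_pivots.1 hmem.1).2
      simp [hmem.2, this] at h1
    · intro r hr hrp
      rcases lt_or_gt_of_ne hrp with h | h
      · have : a r = 0 := by
          by_contra har
          have := Finset.min'_le ((pivots N B).filter fun p => a p ≠ 0) r (by simp [hr, har])
          omega
        simp [this]
      · simp [hB r hr p h]
    · intro h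
      exact absurd hmem.1 h

/-- The indicator of the non-pivot positions vanishes at all pivots, so it could lie in the span
only by being zero; then all `N` positions would be pivots. -/
theorem Echelon.indicator_notMem {N : ℕ} {B : ℕ → ℕ → K} (hB : Echelon N B)
    (hcard : (pivots N B).card < N) :
    (fun c => if c < N then if B c c = 0 then (1 : K) else 0 else 0) ∉ rowSpan N B := by
  intro hmem
  have h := hB.eq_zero hmem fun p hp => by
    have := mem_pivots.1 hp
    simp [this.2]
  have hall : ∀ c < N, B c c ≠ 0 := fun c hc h0 => by
    have := congrFun h c
    simp [hc, h0] at this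
  have : pivots N B = Finset.range N := by
    ext c
    simp only [mem_pivots, Finset.mem_range, and_iff_left_iff_imp]
    exact hall c
  rw [this, Finset.card_range] at hcard
  exact lt_irrefl _ hcard

/-- The row that is used for clearing the `p`-th entry of `w`. -/
def pivotRow (B : ℕ → ℕ → K) (w : ℕ → K) (p : ℕ) : ℕ → K := if B p p = 0 then w else B p

/-- The rows after one round of the elimination. -/
def reduceRows (B : ℕ → ℕ → K) (w : ℕ → K) (p : ℕ) : ℕ → ℕ → K :=
  Function.update B p (pivotRow B w p)

/-- The vector after one round of the elimination. -/
def reduceVec (B : ℕ → ℕ → K) (w : ℕ → K) (p : ℕ) : ℕ → K :=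
  w - (w p * (pivotRow B w p p)⁻¹) • pivotRow B w p

/-- The combined progress of some rounds of the elimination. -/
structure ReducesTo (N : ℕ) (B : ℕ → ℕ → K) (w : ℕ → K) (B' : ℕ → ℕ → K) (w' : ℕ → K) : Prop where
  span_le : rowSpan N B ≤ rowSpan N B'
  sub_mem : w - w' ∈ rowSpan N B'
  card_le : (pivots N B').card + (if w' = 0 then 0 else 1) ≤
    (pivots N B).card + (if w = 0 then 0 else 1)

theorem ReducesTo.refl (N : ℕ) (B : ℕ → ℕ → K) (w : ℕ → K) : ReducesTo N B w B w :=
  ⟨le_rfl, by simp, le_rfl⟩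

theorem ReducesTo.trans {N : ℕ} {B B' B'' : ℕ → ℕ → K} {w w' w'' : ℕ → K}
    (h : ReducesTo N B w B' w') (h' : ReducesTo N B' w' B'' w'') : ReducesTo N B w B'' w'' :=
  ⟨h.span_le.trans h'.span_le, by
    have := add_mem (h'.span_le h.sub_mem) h'.sub_mem
    simpa using this, h'.card_le.trans h.card_le⟩

theorem pivots_reduceRows {N : ℕ} {B : ℕ → ℕ → K} {w : ℕ → K} {p : ℕ} (hp : p < N) :
    pivots N (reduceRows B w p) = if w p = 0 then pivots N B else insert p (pivots N B) := by
  ext r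
  by_cases hr : r = p
  · subst hr
    by_cases hB : B r r = 0 <;> by_cases hw : w r = 0 <;>
      simp [mem_pivots, reduceRows, pivotRow, hB, hw, hp]
  · by_cases hw : w p = 0 <;> simp [mem_pivots, reduceRows, hw, hr]

theorem reduceRows_apply {N : ℕ} {B : ℕ → ℕ → K} {w : ℕ → K} {p r : ℕ} (hr : r ∈ pivots N B) :
    reduceRows B w p r = B r := by
  by_cases h : r = p
  · subst h
    simp [reduceRows, pivotRow, (mem_pivots.1 hr).2]
  · simp [reduceRows, h]

theorem rowSpan_le_reduceRows {N : ℕ} {B : ℕ → ℕ → K} {w : ℕ → K} {p : ℕ} (hp : p < N) :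
    rowSpan N B ≤ rowSpan N (reduceRows B w p) := by
  rw [rowSpan, Submodule.span_le]
  rintro _ ⟨r, hr, rfl⟩
  rw [← reduceRows_apply (w := w) (p := p) hr]
  refine row_mem_rowSpan ?_
  rw [pivots_reduceRows hp]
  split_ifs
  · exact hr
  · exact Finset.mem_insert_of_mem hr

theorem Echelon.reduceRows {N : ℕ} {B : ℕ → ℕ → K} {w : ℕ → K} {p : ℕ} (hB : Echelon N B)
    (hw : ∀ c < p, w c = 0) : Echelon N (reduceRows B w p) := by
  intro r hr c hc
  by_cases h : r = p
  · subst h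
    by_cases h0 : B r r = 0
    · simp [NCABP.reduceRows, pivotRow, h0, hw c hc]
    · have := hB r (mem_pivots.2 ⟨(mem_pivots.1 hr).1, h0⟩) c hc
      simp [NCABP.reduceRows, pivotRow, h0, this]
  · have h1 : NCABP.reduceRows B w p r = B r := by simp [NCABP.reduceRows, h]
    have h2 := mem_pivots.1 hr
    rw [h1] at h2 ⊢
    exact hB r (mem_pivots.2 h2) c hc

theorem Echelon.reduceVec_eq_zero {N : ℕ} {B : ℕ → ℕ → K} {w : ℕ → K} {p : ℕ} (hB : Echelon N B)
    (hp : p < N) (hw : ∀ c < p, w c = 0) : ∀ c < p + 1, reduceVec B w p c = 0 := by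
  intro c hc
  rcases Nat.lt_succ_iff_lt_or_eq.1 hc with h | rfl
  · by_cases h0 : B p p = 0
    · simp [reduceVec, pivotRow, h0, hw c h]
    · simp [reduceVec, pivotRow, h0, hw c h, hB p (mem_pivots.2 ⟨hp, h0⟩) c h]
  · by_cases h0 : B c c = 0
    · by_cases hwc : w c = 0 <;> simp [reduceVec, pivotRow, h0, hwc]
    · simp [reduceVec, pivotRow, h0]

/-- If `w p = 0`, the vector and the set of pivots stay the same; row `p` may be overwritten, but
only while out of use, and it stays so. If `w p ≠ 0` and row `p` is free, `w` becomes that row and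
is subtracted from itself: a new pivot is paid for by the vector becoming zero. Otherwise a row
already in use is subtracted. -/
theorem reducesTo_reduce {N : ℕ} {B : ℕ → ℕ → K} {w : ℕ → K} {p : ℕ} (hp : p < N) :
    ReducesTo N B w (reduceRows B w p) (reduceVec B w p) := by
  refine ⟨rowSpan_le_reduceRows hp, ?_, ?_⟩
  · have hsub : w - reduceVec B w p = (w p * (pivotRow B w p p)⁻¹) • pivotRow B w p := by
      simp [reduceVec]
    rw [hsub]
    -- With a zero pivot entry the factor is zero, since `0⁻¹ = 0`.
    by_cases hpp : pivotRow B w p p = 0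
    · simp [hpp]
    · refine Submodule.smul_mem _ _ ?_
      have h1 : reduceRows B w p p = pivotRow B w p := by simp [reduceRows]
      rw [← h1]
      refine row_mem_rowSpan (mem_pivots.2 ⟨hp, ?_⟩)
      rwa [h1]
  · rw [pivots_reduceRows hp]
    by_cases hw : w p = 0
    · have : reduceVec B w p = w := by simp [reduceVec, hw]
      simp [hw, this]
    · have hw0 : w ≠ 0 := fun h => hw (by simp [h])
      by_cases hB : B p p = 0
      · have h1 : reduceVec B w p = 0 := by simp [reduceVec, pivotRow, hB, hw]
        have h2 := Finset.card_insert_le p (pivots N B)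
        simp [hw, h1, hw0, h2]
      · have h1 : insert p (pivots N B) = pivots N B :=
          Finset.insert_eq_of_mem (mem_pivots.2 ⟨hp, hB⟩)
        simp only [hw, h1, hw0, if_false]
        split_ifs <;> omega

end Echelon

/-! ### Words and their positions -/

section Words

variable {n : ℕ}

/-- Word numbers are left folds and right quotients strip final letters, so words are built up at
their end. -/
theorem snoc_induction {motive : FreeMonoid (Fin n) → Prop} (one : motive 1)
    (mul_of : ∀ w x, motive w → motive (w * FreeMonoid.of x)) (w : FreeMonoid (Fin n)) :
    motive w :=
  List.reverseRecOn (motive := motive) w one fun l x h => mul_of l x h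

theorem eq_one_or_eq_mul_of (w : FreeMonoid (Fin n)) :
    w = 1 ∨ ∃ u x, w = u * FreeMonoid.of x :=
  snoc_induction (motive := fun w => w = 1 ∨ ∃ u x, w = u * FreeMonoid.of x) (Or.inl rfl)
    (fun u x _ => Or.inr ⟨u, x, rfl⟩) w

theorem mul_of_inj {u v : FreeMonoid (Fin n)} {x y : Fin n} :
    u * FreeMonoid.of x = v * FreeMonoid.of y ↔ u = v ∧ x = y := by
  constructor
  · intro h
    have h' : u.toList ++ [x] = v.toList ++ [y] := congrArg FreeMonoid.toList h
    have := List.append_inj' h' rfl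
    exact ⟨this.1, by simpa using this.2⟩
  · rintro ⟨rfl, rfl⟩
    rfl

theorem mul_of_ne_one (u : FreeMonoid (Fin n)) (x : Fin n) : u * FreeMonoid.of x ≠ 1 := fun h => by
  have := congrArg FreeMonoid.length h
  simp at this

/-- Words of the same total length that agree after splitting at the same place. -/
theorem mul_eq_mul_of_length {a b c e : FreeMonoid (Fin n)} (h : a * b = c * e)
    (hl : a.length = c.length) : a = c ∧ b = e :=
  List.append_inj (show a.toList ++ b.toList = c.toList ++ e.toList from h) hl

/-- Every word can be split after any number of letters. -/
theorem exists_eq_mul (w : FreeMonoid (Fin n)) {k : ℕ} (hk : k ≤ w.length) :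
    ∃ a b, w = a * b ∧ a.length = k := by
  refine ⟨FreeMonoid.ofList (w.toList.take k), FreeMonoid.ofList (w.toList.drop k), ?_, ?_⟩
  · exact (List.take_append_drop k w.toList).symm
  · exact List.length_take_of_le hk

/-- The number of words of length less than `s`. -/
def offset (n s : ℕ) : ℕ := ∑ i ∈ Finset.range s, n ^ i

theorem offset_succ (n s : ℕ) : offset n (s + 1) = offset n s + n ^ s := Finset.sum_range_succ _ _

theorem mul_offset_add_one (n s : ℕ) : n * offset n s + 1 = offset n (s + 1) := by
  rw [offset, offset, Finset.sum_range_succ', Finset.mul_sum]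
  simp [pow_succ, mul_comm]

theorem offset_mono (n : ℕ) : Monotone (offset n) :=
  monotone_nat_of_le_succ fun s => by simp [offset_succ]

/-- The number of a word among the words of the same length. -/
def wordIndex (w : FreeMonoid (Fin n)) : ℕ := w.toList.foldl (fun q a => n * q + (a : ℕ)) 0

theorem wordIndex_one : wordIndex (1 : FreeMonoid (Fin n)) = 0 := rfl

theorem wordIndex_mul_of (w : FreeMonoid (Fin n)) (x : Fin n) :
    wordIndex (w * FreeMonoid.of x) = n * wordIndex w + x := by
  simp [wordIndex, FreeMonoid.toList_mul]

theorem position_mul_of (w : FreeMonoid (Fin n)) (x : Fin n) :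
    position (w * FreeMonoid.of x) = n * position w + x + 1 := by
  simp [position, FreeMonoid.toList_mul]

/-- The recursion for `position` differs from that for `wordIndex` by one extra `+ 1` per letter;
these accumulate to `1 + n + n ^ 2 + ⋯`. -/
theorem position_eq (w : FreeMonoid (Fin n)) : position w = offset n w.length + wordIndex w := by
  induction w using snoc_induction with
  | one => simp [position, wordIndex, offset]
  | mul_of w x ih =>
    rw [position_mul_of, wordIndex_mul_of, ih, FreeMonoid.length_mul, FreeMonoid.length_of,
      ← mul_offset_add_one]
    ring

theorem wordIndex_lt (w : FreeMonoid (Fin n)) : wordIndex w < n ^ w.length := by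
  induction w using snoc_induction with
  | one => simp [wordIndex]
  | mul_of w x ih =>
    rw [wordIndex_mul_of, FreeMonoid.length_mul, FreeMonoid.length_of, pow_succ]
    have := x.2
    nlinarith

theorem wordIndex_mul (u v : FreeMonoid (Fin n)) :
    wordIndex (u * v) = wordIndex u * n ^ v.length + wordIndex v := by
  induction v using snoc_induction with
  | one => simp [wordIndex_one]
  | mul_of v x ih =>
    rw [← mul_assoc, wordIndex_mul_of, wordIndex_mul_of, ih, FreeMonoid.length_mul,
      FreeMonoid.length_of]
    ring

theorem wordIndex_mul_div (u v : FreeMonoid (Fin n)) :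
    wordIndex (u * v) / n ^ v.length = wordIndex u := by
  have h := wordIndex_lt v
  rw [wordIndex_mul, mul_comm, Nat.mul_add_div (by omega), Nat.div_eq_of_lt h, add_zero]

theorem wordIndex_mul_mod (u v : FreeMonoid (Fin n)) :
    wordIndex (u * v) % n ^ v.length = wordIndex v := by
  rw [wordIndex_mul, mul_comm, Nat.mul_add_mod, Nat.mod_eq_of_lt (wordIndex_lt v)]

theorem wordIndex_injective {u v : FreeMonoid (Fin n)} (hl : u.length = v.length)
    (h : wordIndex u = wordIndex v) : u = v := by
  induction u using snoc_induction generalizing v with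
  | one => exact (FreeMonoid.length_eq_zero.1 hl.symm).symm
  | mul_of u x ih =>
    rcases eq_one_or_eq_mul_of v with rfl | ⟨v, y, rfl⟩
    · simp at hl
    · have hx := wordIndex_mul_mod u (FreeMonoid.of x)
      have hy := wordIndex_mul_mod v (FreeMonoid.of y)
      have hx' := wordIndex_mul_div u (FreeMonoid.of x)
      have hy' := wordIndex_mul_div v (FreeMonoid.of y)
      rw [FreeMonoid.length_of] at hx hy hx' hy'
      rw [h] at hx hx'
      refine mul_of_inj.2 ⟨ih (by simpa using hl) (hx'.symm.trans hy'), ?_⟩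
      have h1 := hx.symm.trans hy
      have h2 : ∀ z : Fin n, wordIndex (FreeMonoid.of z) = z := fun z => by simp [wordIndex]
      rw [h2, h2] at h1
      exact Fin.ext h1

theorem exists_wordIndex_eq {s q : ℕ} (hq : q < n ^ s) :
    ∃ w : FreeMonoid (Fin n), w.length = s ∧ wordIndex w = q := by
  induction s generalizing q with
  | zero => exact ⟨1, rfl, by simp at hq; simp [hq, wordIndex_one]⟩
  | succ s ih =>
    have hn : 0 < n := by
      rcases Nat.eq_zero_or_pos n with rfl | h
      · simp at hq
      · exact h
    have h1 : q / n < n ^ s := Nat.div_lt_of_lt_mul (by rwa [pow_succ'] at hq)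
    obtain ⟨w, hw, hi⟩ := ih h1
    refine ⟨w * FreeMonoid.of ⟨q % n, Nat.mod_lt _ hn⟩, by simp [hw], ?_⟩
    rw [wordIndex_mul_of, hi]
    exact Nat.div_add_mod q n

/-- The word of length `s` with number `q`. -/
def word (n s q : ℕ) : FreeMonoid (Fin n) :=
  if hq : q < n ^ s then (exists_wordIndex_eq hq).choose else 1

theorem length_word {s q : ℕ} (hq : q < n ^ s) : (word n s q).length = s := by
  rw [word, dif_pos hq]
  exact (exists_wordIndex_eq hq).choose_spec.1

theorem wordIndex_word {s q : ℕ} (hq : q < n ^ s) : wordIndex (word n s q) = q := by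
  rw [word, dif_pos hq]
  exact (exists_wordIndex_eq hq).choose_spec.2

theorem length_eq_of_position {w : FreeMonoid (Fin n)} {s b : ℕ} (hb : b < n ^ s)
    (h : position w = offset n s + b) : w.length = s := by
  rw [position_eq] at h
  have hw := wordIndex_lt w
  rcases lt_trichotomy w.length s with hl | hl | hl
  · have := offset_mono n (Nat.succ_le_of_lt hl)
    rw [Nat.succ_eq_add_one, offset_succ] at this
    omega
  · exact hl
  · have := offset_mono n (Nat.succ_le_of_lt hl)
    rw [Nat.succ_eq_add_one, offset_succ] at this
    omega

theorem position_injective : Function.Injective (position (n := n)) := by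
  intro u v h
  have hl : u.length = v.length := length_eq_of_position (wordIndex_lt v) (by rw [h, position_eq])
  refine wordIndex_injective hl ?_
  rw [position_eq, position_eq, hl] at h
  omega

variable {K : Type*} [Field K]

theorem coeffAt_position (f : NCPoly K n) (w : FreeMonoid (Fin n)) :
    coeffAt f (position w) = f.coeff w := by
  have h : (f.coeff.support.filter fun v => position v = position w) =
      f.coeff.support.filter fun v => v = w :=
    Finset.filter_congr fun v _ => position_injective.eq_iff
  rw [coeffAt, h, Finset.sum_filter, Finset.sum_ite_eq']
  split_ifs with hw
  · rfl
  · exact (Finsupp.notMem_support_iff.1 hw).symm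

theorem exists_of_coeffAt_ne_zero {f : NCPoly K n} {q : ℕ} (h : coeffAt f q ≠ 0) :
    ∃ w, position w = q ∧ f.coeff w ≠ 0 := by
  obtain ⟨w, hw, h0⟩ := Finset.exists_ne_zero_of_sum_ne_zero h
  exact ⟨w, (Finset.mem_filter.1 hw).2, h0⟩

end Words

/-! ### Right quotients -/

section RightQuot

variable {K : Type*} [Field K] {n : ℕ}

theorem mul_right_inj_freeMonoid (q : FreeMonoid (Fin n)) :
    Function.Injective fun w : FreeMonoid (Fin n) => w * q := fun _ _ h => mul_right_cancel h

/-- The polynomial whose coefficient at `w` is that of `f` at `w * q`. -/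
def rightQuot (q : FreeMonoid (Fin n)) : NCPoly K n →ₗ[K] NCPoly K n where
  toFun f := MonoidAlgebra.ofCoeff
    (f.coeff.comapDomain (fun w => w * q) (mul_right_inj_freeMonoid q).injOn)
  map_add' f g := by ext w; simp
  map_smul' c f := by ext w; simp

@[simp] theorem coeff_rightQuot (q w : FreeMonoid (Fin n)) (f : NCPoly K n) :
    (rightQuot q f).coeff w = f.coeff (w * q) := by
  simp [rightQuot]

theorem rightQuot_one (f : NCPoly K n) : rightQuot 1 f = f := by
  ext w; simp

theorem rightQuot_rightQuot (a b : FreeMonoid (Fin n)) (f : NCPoly K n) :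
    rightQuot a (rightQuot b f) = rightQuot (a * b) f := by
  ext w; simp [mul_assoc]

theorem rightQuot_apply_one {q : FreeMonoid (Fin n)} (hq : q ≠ 1) :
    rightQuot q (1 : NCPoly K n) = 0 := by
  ext w
  have : w * q ≠ 1 := fun h => hq (by
    have := congrArg FreeMonoid.length h
    rw [FreeMonoid.length_mul, FreeMonoid.length_one] at this
    exact FreeMonoid.length_eq_zero.1 (by omega))
  simp [MonoidAlgebra.one_def, this.symm]

theorem rightQuot_of_single (x : Fin n) (b : FreeMonoid (Fin n)) (y : Fin n) (s : K) :
    rightQuot (FreeMonoid.of x) (MonoidAlgebra.single (b * FreeMonoid.of y) s : NCPoly K n) =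
      if y = x then MonoidAlgebra.single b s else 0 := by
  ext w
  by_cases h : y = x
  · subst h
    simp [Finsupp.single_apply]
  · have : ¬ b * FreeMonoid.of y = w * FreeMonoid.of x := fun e => h (mul_of_inj.1 e).2
    simp [h, this]

theorem rightQuot_of_single_one (x : Fin n) (s : K) :
    rightQuot (FreeMonoid.of x) (MonoidAlgebra.single 1 s : NCPoly K n) = 0 := by
  ext w
  simp [Finsupp.single_eq_of_ne (mul_of_ne_one w x)]

/-- A product rule: the last letter of a word of `f * g` comes from `g`, unless the factor from `g`
is the empty word. -/
theorem rightQuot_of_mul (x : Fin n) (f g : NCPoly K n) :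
    rightQuot (FreeMonoid.of x) (f * g) =
      f * rightQuot (FreeMonoid.of x) g + g.coeff 1 • rightQuot (FreeMonoid.of x) f := by
  induction f using MonoidAlgebra.induction_linear with
  | zero => simp
  | add f₁ f₂ h₁ h₂ => simp only [add_mul, map_add, h₁, h₂, smul_add]; abel
  | single a r =>
    induction g using MonoidAlgebra.induction_linear with
    | zero => simp
    | add g₁ g₂ h₁ h₂ =>
      simp only [mul_add, map_add, h₁, h₂, MonoidAlgebra.coeff_add, Finsupp.add_apply, add_smul]
      abel
    | single b s =>
      rcases eq_one_or_eq_mul_of b with rfl | ⟨b, y, rfl⟩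
      · rw [MonoidAlgebra.single_mul_single, rightQuot_of_single_one, mul_zero, zero_add, mul_one,
          ← map_smul]
        simp [mul_comm]
      · rw [MonoidAlgebra.single_mul_single, ← mul_assoc, rightQuot_of_single, rightQuot_of_single]
        simp only [MonoidAlgebra.coeff_single,
          Finsupp.single_eq_of_ne (mul_of_ne_one b y).symm, zero_smul, add_zero]
        split_ifs
        · rw [MonoidAlgebra.single_mul_single]
        · rw [mul_zero]

/-- Iterating the product rule: either `g` supplies all of `q`, or `g` supplies only a suffix `b` as
a whole word, which leaves a scalar times the quotient of `f` by the nonempty prefix `a`. -/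
theorem rightQuot_mul_sub_mem (q : FreeMonoid (Fin n)) (f g : NCPoly K n) :
    rightQuot q (f * g) - f * rightQuot q g ∈
      Submodule.span K {x | ∃ a b, a ≠ 1 ∧ q = a * b ∧ x = rightQuot a f} := by
  induction q using snoc_induction generalizing g with
  | one => simp [rightQuot_one]
  | mul_of q x ih =>
    rw [← rightQuot_rightQuot, ← rightQuot_rightQuot, rightQuot_of_mul, map_add, map_smul,
      rightQuot_rightQuot q _ f, add_sub_right_comm]
    refine add_mem ?_ (Submodule.smul_mem _ _ (Submodule.subset_span
      ⟨_, 1, mul_of_ne_one q x, (mul_one _).symm, rfl⟩))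
    refine Submodule.span_mono ?_ (ih (rightQuot (FreeMonoid.of x) g))
    rintro _ ⟨a, b, ha, rfl, rfl⟩
    exact ⟨a, b * FreeMonoid.of x, ha, mul_assoc _ _ _, rfl⟩

theorem coeff_mul_one (f g : NCPoly K n) : (f * g).coeff 1 = f.coeff 1 * g.coeff 1 := by
  induction f using MonoidAlgebra.induction_linear with
  | zero => simp
  | add f₁ f₂ h₁ h₂ => simp [add_mul, h₁, h₂]
  | single a r =>
    induction g using MonoidAlgebra.induction_linear with
    | zero => simp
    | add g₁ g₂ h₁ h₂ => simp only [mul_add, h₁, h₂, MonoidAlgebra.coeff_add, Finsupp.add_apply]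
    | single b s =>
      rw [MonoidAlgebra.single_mul_single]
      simp only [MonoidAlgebra.coeff_single, Finsupp.single_apply]
      by_cases ha : a = 1
      · simp [ha]
      · have : a * b ≠ 1 := fun h => ha (by
          have := congrArg FreeMonoid.length h
          rw [FreeMonoid.length_mul, FreeMonoid.length_one] at this
          exact FreeMonoid.length_eq_zero.1 (by omega))
        simp [ha, this]

/-- A polynomial without its constant term. -/
def dropConst : NCPoly K n →ₗ[K] NCPoly K n where
  toFun f := MonoidAlgebra.ofCoeff (f.coeff.erase 1)
  map_add' f g := by ext w; simp [Finsupp.erase_add]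
  map_smul' c f := by
    ext w
    by_cases hw : w = 1 <;> simp [hw]

theorem coeff_dropConst (f : NCPoly K n) (w : FreeMonoid (Fin n)) :
    (dropConst f).coeff w = if w = 1 then 0 else f.coeff w := by
  simp [dropConst, Finsupp.erase_apply]

theorem dropConst_eq_self {f : NCPoly K n} (hf : f.coeff 1 = 0) : dropConst f = f := by
  ext w
  rw [coeff_dropConst]
  split_ifs with h
  · rw [h, hf]
  · rfl

/-- The quotient of a variable by a nonempty word is a constant. Dropping constants is thus what
makes the variables in the edge labels disappear. -/
theorem dropConst_rightQuot_ncVar {a : FreeMonoid (Fin n)} (ha : a ≠ 1) (i : Fin n) :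
    dropConst (rightQuot a (ncVar K i)) = 0 := by
  ext w
  rw [coeff_dropConst]
  split_ifs with h
  · rfl
  · have : FreeMonoid.of i ≠ w * a := fun e => by
      have e' := congrArg FreeMonoid.length e
      rw [FreeMonoid.length_mul, FreeMonoid.length_of] at e'
      have h1 : w.length ≠ 0 := fun h' => h (FreeMonoid.length_eq_zero.1 h')
      have h2 : a.length ≠ 0 := fun h' => ha (FreeMonoid.length_eq_zero.1 h')
      omega
    simp [ncVar, this]

end RightQuot

/-! ### Right quotients of the polynomials of a branching program -/

namespace ABP

variable {K : Type*} [Field K] {n m : ℕ}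

/-- Paths are split at their first edge, so that the polynomials to a fixed sink satisfy a recursion
with the edge polynomials as left factors. -/
theorem polyBetween_eq (A : ABP K n m) (h : Fin m → NCPoly K n) (u v : Fin A.size) :
    A.polyBetween h u v = (if u = v then 1 else 0) +
      ∑ e ∈ A.edges with e.1 = u, A.edgePoly h e * A.polyBetween h e.2 v := by
  have hset : (A.finite_setOf_isPath u v).toFinset =
      (if u = v then {[]} else ∅) ∪ ((A.edges.filter fun e => e.1 = u).biUnion fun e =>
        (A.finite_setOf_isPath e.2 v).toFinset.image (List.cons e)) := by
    ext p
    cases p with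
    | nil =>
      simp only [Set.Finite.mem_toFinset, Set.mem_ofPred_eq, IsPath, Finset.mem_union,
        Finset.mem_biUnion, Finset.mem_image]
      split_ifs with huv <;> simp [huv]
    | cons e p =>
      have h1 : e :: p ∉ (if u = v then {[]} else ∅ : Finset (List (Fin A.size × Fin A.size))) := by
        split_ifs <;> simp
      simp only [Set.Finite.mem_toFinset, Set.mem_ofPred_eq, IsPath, Finset.mem_union,
        Finset.mem_biUnion, Finset.mem_image, h1, false_or, Finset.mem_filter, List.cons.injEq]
      constructor
      · rintro ⟨he, hu, hp⟩
        exact ⟨e, ⟨he, hu⟩, p, hp, rfl, rfl⟩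
      · rintro ⟨e', ⟨he, hu⟩, p', hp, rfl, rfl⟩
        exact ⟨he, hu, hp⟩
  rw [polyBetween, hset, Finset.sum_union, Finset.sum_biUnion]
  · congr 1
    · split_ifs <;> simp [pathPoly]
    · refine Finset.sum_congr rfl fun e _ => ?_
      rw [Finset.sum_image (fun a _ b _ hab => (List.cons.inj hab).2), polyBetween, Finset.mul_sum]
      refine Finset.sum_congr rfl fun p _ => ?_
      simp [pathPoly]
  · intro e _ e' _ hne
    rw [Function.onFun, Finset.disjoint_left]
    intro p hp hp'
    obtain ⟨a, _, rfl⟩ := Finset.mem_image.1 hp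
    obtain ⟨b, _, hb⟩ := Finset.mem_image.1 hp'
    exact hne (List.cons.inj hb).1.symm
  · rw [Finset.disjoint_left]
    intro p hp hp'
    obtain ⟨e, _, he⟩ := Finset.mem_biUnion.1 hp'
    obtain ⟨a, _, rfl⟩ := Finset.mem_image.1 he
    split_ifs at hp <;> simp at hp

end ABP

section Ideal

variable {K : Type*} [Field K] {n m : ℕ}

/-- The left ideal generated by the right quotients of the help polynomials by the nonempty
prefixes of words in `Q`, without their constant terms. -/
def quotIdeal (h : Fin m → NCPoly K n) (Q : Set (FreeMonoid (Fin n))) :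
    Submodule (NCPoly K n) (NCPoly K n) :=
  Submodule.span (NCPoly K n)
    {x | ∃ q ∈ Q, ∃ a b, a ≠ 1 ∧ q = a * b ∧ ∃ j, x = dropConst (rightQuot a (h j))}

theorem smul_mem_quotIdeal {h : Fin m → NCPoly K n} {Q : Set (FreeMonoid (Fin n))} (c : K)
    {x : NCPoly K n} (hx : x ∈ quotIdeal h Q) : c • x ∈ quotIdeal h Q := by
  have : c • x = (c • (1 : NCPoly K n)) * x := by rw [smul_mul_assoc, one_mul]
  rw [this]
  exact Submodule.smul_mem _ _ hx

theorem dropConst_rightQuot_edgePoly_mem (A : ABP K n m) (h : Fin m → NCPoly K n)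
    {Q : Set (FreeMonoid (Fin n))} {q a b : FreeMonoid (Fin n)} (hq : q ∈ Q) (ha : a ≠ 1)
    (hab : q = a * b) (e : Fin A.size × Fin A.size) :
    dropConst (rightQuot a (A.edgePoly h e)) ∈ quotIdeal h Q := by
  simp only [ABP.edgePoly, map_add, map_sum, map_smul, dropConst_rightQuot_ncVar ha, smul_zero,
    Finset.sum_const_zero, zero_add]
  exact sum_mem fun j _ => smul_mem_quotIdeal _ (Submodule.subset_span ⟨q, hq, a, b, ha, hab, j, rfl⟩)

/-- Let `R` be the combination of quotients. On each summand `L * f` of the recursion at `u`, `R (L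
* f)` is `L * R f` plus quotients of the edge polynomial `L` by nonempty prefixes. The first term is
in the ideal by induction, as it is a left ideal, and the others are in it after their constants are
dropped. The relation `hc` says that every `R f` has zero constant term, so dropping constants loses
nothing. -/
theorem sum_smul_rightQuot_polyBetween_mem (A : ABP K n m) (h : Fin m → NCPoly K n)
    {ι : Type*} (I : Finset ι) (c : ι → K) (q : ι → FreeMonoid (Fin n)) (hq : ∀ i ∈ I, q i ≠ 1)
    (t : Fin A.size) (hc : ∀ v, ∑ i ∈ I, c i * (A.polyBetween h v t).coeff (q i) = 0)
    (u : Fin A.size) :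
    ∑ i ∈ I, c i • rightQuot (q i) (A.polyBetween h u t) ∈ quotIdeal h (q '' (I : Set ι)) := by
  -- Layers increase along edges, so the distance to the top layer decreases.
  set M : ℕ := Finset.univ.sup A.layer with hM
  induction hk : M - A.layer u using Nat.strong_induction_on generalizing u with
  | _ k ih =>
    set Rc : NCPoly K n →ₗ[K] NCPoly K n := ∑ i ∈ I, c i • rightQuot (q i) with hRc
    have hRc_apply : ∀ f, Rc f = ∑ i ∈ I, c i • rightQuot (q i) f := fun f => by
      simp [hRc, LinearMap.sum_apply]
    have hconst : ∀ v, (Rc (A.polyBetween h v t)).coeff 1 = 0 := fun v => by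
      rw [hRc_apply, MonoidAlgebra.coeff_sum, Finsupp.finsetSum_apply, ← hc v]
      exact Finset.sum_congr rfl fun i _ => by simp
    -- Constants are dropped before expanding, because single summands of the expansion may have
    -- nonzero constant terms.
    rw [← hRc_apply, ← dropConst_eq_self (hconst u), A.polyBetween_eq h u t, map_add, map_add,
      map_sum, map_sum]
    refine add_mem ?_ (sum_mem fun e he => ?_)
    · have : Rc (if u = t then 1 else 0) = 0 := by
        split_ifs
        · rw [hRc_apply]
          exact Finset.sum_eq_zero fun i hi => by rw [rightQuot_apply_one (hq i hi), smul_zero]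
        · rw [map_zero]
      rw [this, map_zero]
      exact zero_mem _
    · rw [Finset.mem_filter] at he
      have hlt := A.layer_lt e he.1
      rw [he.2] at hlt
      have hle : A.layer e.2 ≤ M := Finset.le_sup (f := A.layer) (Finset.mem_univ e.2)
      have hmem := ih (M - A.layer e.2) (by omega) e.2 rfl
      rw [← hRc_apply] at hmem
      have hsplit : Rc (A.edgePoly h e * A.polyBetween h e.2 t) =
          A.edgePoly h e * Rc (A.polyBetween h e.2 t) +
          ∑ i ∈ I, c i • (rightQuot (q i) (A.edgePoly h e * A.polyBetween h e.2 t) -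
            A.edgePoly h e * rightQuot (q i) (A.polyBetween h e.2 t)) := by
        simp only [hRc_apply, smul_sub, Finset.sum_sub_distrib, Finset.mul_sum, mul_smul_comm]
        abel
      rw [hsplit, map_add, map_sum, dropConst_eq_self (f := A.edgePoly h e * _)
        (by rw [coeff_mul_one, hconst, mul_zero])]
      refine add_mem (Submodule.smul_mem _ _ hmem) (sum_mem fun i hi => ?_)
      rw [map_smul]
      refine smul_mem_quotIdeal _ ?_
      have h1 := rightQuot_mul_sub_mem (q i) (A.edgePoly h e) (A.polyBetween h e.2 t)
      have h2 : Submodule.span K {x | ∃ a b, a ≠ 1 ∧ q i = a * b ∧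
          x = rightQuot a (A.edgePoly h e)} ≤
          ((quotIdeal h (q '' (I : Set ι))).restrictScalars K).comap dropConst := by
        rw [Submodule.span_le]
        rintro _ ⟨a, b, ha, hab, rfl⟩
        exact dropConst_rightQuot_edgePoly_mem A h (Set.mem_image_of_mem q hi) ha hab e
      exact h2 h1

end Ideal

/-! ### Programs without computed natural numbers -/

/-- All variables of the expression are less than `v`. -/
def NExpr.Scoped (v : ℕ) : NExpr → Prop
  | .const _ => True
  | .var x => x < v
  | .get _ i => i.Scoped v
  | .add e₁ e₂ => e₁.Scoped v ∧ e₂.Scoped v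
  | .sub e₁ e₂ => e₁.Scoped v ∧ e₂.Scoped v
  | .mul e₁ e₂ => e₁.Scoped v ∧ e₂.Scoped v
  | .div e₁ e₂ => e₁.Scoped v ∧ e₂.Scoped v
  | .mod e₁ e₂ => e₁.Scoped v ∧ e₂.Scoped v

/-- All variables of the expression are less than `v`. -/
def FExpr.Scoped (v : ℕ) : FExpr → Prop
  | .zero => True
  | .one => True
  | .get _ i => i.Scoped v
  | .add e₁ e₂ => e₁.Scoped v ∧ e₂.Scoped v
  | .sub e₁ e₂ => e₁.Scoped v ∧ e₂.Scoped v
  | .mul e₁ e₂ => e₁.Scoped v ∧ e₂.Scoped v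
  | .inv e => e.Scoped v

/-- The program changes no natural numbers except for its loop variables, these are `v`, `v + 1`, …
from the outermost loops to the innermost ones, and it uses a loop variable only inside its loop. -/
def Prog.Scoped : ℕ → Prog → Prop
  | _, .skip => True
  | v, .seq c₁ c₂ => c₁.Scoped v ∧ c₂.Scoped v
  | _, .setVar _ _ => False
  | _, .setNat _ _ _ => False
  | v, .setField _ i e => i.Scoped v ∧ e.Scoped v
  | v, .ifLt e₁ e₂ c₁ c₂ => e₁.Scoped v ∧ e₂.Scoped v ∧ c₁.Scoped v ∧ c₂.Scoped v
  | v, .ifZero e c₁ c₂ => e.Scoped v ∧ c₁.Scoped v ∧ c₂.Scoped v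
  | v, .loop x e c => x = v ∧ e.Scoped v ∧ c.Scoped (v + 1)

/-- The program does not write to the field array `a`. -/
def Prog.Avoids (a : ℕ) : Prog → Prop
  | .skip => True
  | .seq c₁ c₂ => c₁.Avoids a ∧ c₂.Avoids a
  | .setVar _ _ => True
  | .setNat _ _ _ => True
  | .setField b _ _ => b ≠ a
  | .ifLt _ _ c₁ c₂ => c₁.Avoids a ∧ c₂.Avoids a
  | .ifZero _ c₁ c₂ => c₁.Avoids a ∧ c₂.Avoids a
  | .loop _ _ c => c.Avoids a

section Time

variable {K : Type*}

theorem iterate_induction {x : ℕ} {body : State K → State K} {s : State K}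
    {motive : ℕ → State K → Prop} (N : ℕ) (h0 : motive 0 s)
    (hs : ∀ k < N, ∀ t, motive k t → motive (k + 1) (body (t.setVar x k))) :
    ∀ k ≤ N, motive k (iterate x body s k)
  | 0, _ => h0
  | k + 1, hk => hs k hk _ (iterate_induction N h0 hs k (Nat.le_of_succ_le hk))

/-- The states have the same natural numbers, up to the variables from `v` on. -/
structure SameNat (v : ℕ) (s t : State K) : Prop where
  var_eq : ∀ x < v, t.var x = s.var x
  nat_eq : t.nat = s.nat

theorem SameNat.refl (v : ℕ) (s : State K) : SameNat v s s := ⟨fun _ _ => rfl, rfl⟩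

theorem SameNat.trans {v : ℕ} {s t u : State K} (h : SameNat v s t) (h' : SameNat v t u) :
    SameNat v s u :=
  ⟨fun x hx => (h'.var_eq x hx).trans (h.var_eq x hx), h'.nat_eq.trans h.nat_eq⟩

theorem SameNat.mono {v w : ℕ} {s t : State K} (h : SameNat w s t) (hvw : v ≤ w) :
    SameNat v s t :=
  ⟨fun x hx => h.var_eq x (hx.trans_le hvw), h.nat_eq⟩

theorem sameNat_setVar (v k : ℕ) (s : State K) : SameNat v s (s.setVar v k) :=
  ⟨fun x hx => by simp [State.setVar, hx.ne], rfl⟩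

theorem sameNat_setField (v a i : ℕ) (z : K) (s : State K) : SameNat v s (s.setField a i z) :=
  ⟨fun _ _ => rfl, rfl⟩

theorem sameNat_iterate {v : ℕ} {body : State K → State K}
    (hb : ∀ s, SameNat (v + 1) s (body s)) (s : State K) (k : ℕ) :
    SameNat v s (iterate v body s k) := by
  induction k with
  | zero => exact SameNat.refl v s
  | succ k ih =>
    exact (ih.trans (sameNat_setVar v k _)).trans ((hb _).mono (Nat.le_succ v))

/-- All variables less than `v` and all entries of natural number arrays are at most `T`. -/
structure Bounded (v T : ℕ) (s : State K) : Prop where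
  var_le : ∀ x < v, s.var x ≤ T
  nat_le : ∀ a i, s.nat a i ≤ T

theorem Bounded.sameNat {v T : ℕ} {s t : State K} (hs : Bounded v T s) (h : SameNat v s t) :
    Bounded v T t :=
  ⟨fun x hx => by rw [h.var_eq x hx]; exact hs.var_le x hx,
    fun a i => by rw [h.nat_eq]; exact hs.nat_le a i⟩

/-- A quantity is at most polynomial in a bound for the variables less than `v` and for the arrays of
natural numbers. -/
def PolyBounded (v : ℕ) (f : State K → ℕ) : Prop :=
  ∃ c, ∀ T s, 2 ≤ T → Bounded v T s → f s ≤ T ^ c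

theorem PolyBounded.mono {v : ℕ} {f g : State K → ℕ} (hg : PolyBounded v g) (h : ∀ s, f s ≤ g s) :
    PolyBounded v f := by
  obtain ⟨c, hc⟩ := hg
  exact ⟨c, fun T s hT hs => (h s).trans (hc T s hT hs)⟩

theorem polyBounded_const (v k : ℕ) : PolyBounded v fun _ : State K => k :=
  ⟨k, fun _ _ hT _ => Nat.lt_two_pow_self.le.trans (Nat.pow_le_pow_left hT k)⟩

theorem polyBounded_var {v x : ℕ} (hx : x < v) : PolyBounded v fun s : State K => s.var x :=
  ⟨1, fun T s _ hs => by rw [pow_one]; exact hs.var_le x hx⟩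

theorem polyBounded_nat {v a : ℕ} (f : State K → ℕ) :
    PolyBounded v fun s : State K => s.nat a (f s) :=
  ⟨1, fun T s _ hs => by rw [pow_one]; exact hs.nat_le a _⟩

theorem PolyBounded.mul {v : ℕ} {f g : State K → ℕ} (hf : PolyBounded v f)
    (hg : PolyBounded v g) : PolyBounded v fun s => f s * g s := by
  obtain ⟨a, ha⟩ := hf
  obtain ⟨b, hb⟩ := hg
  exact ⟨a + b, fun T s hT hs => by
    rw [pow_add]
    exact Nat.mul_le_mul (ha T s hT hs) (hb T s hT hs)⟩

theorem PolyBounded.add {v : ℕ} {f g : State K → ℕ} (hf : PolyBounded v f)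
    (hg : PolyBounded v g) : PolyBounded v fun s => f s + g s := by
  obtain ⟨a, ha⟩ := hf
  obtain ⟨b, hb⟩ := hg
  refine ⟨a + b + 1, fun T s hT hs => ?_⟩
  -- The extra factor `T ≥ 2` absorbs the sum of two terms that are each at most `T ^ (a + b)`.
  have h1 : T ^ a ≤ T ^ (a + b) := Nat.pow_le_pow_right (by omega) (by omega)
  have h2 : T ^ b ≤ T ^ (a + b) := Nat.pow_le_pow_right (by omega) (by omega)
  have h3 : T ^ (a + b) * 2 ≤ T ^ (a + b) * T := Nat.mul_le_mul_left _ hT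
  have h4 := ha T s hT hs
  have h5 := hb T s hT hs
  rw [pow_succ]
  change f s + g s ≤ _
  omega

theorem NExpr.Scoped.polyBounded_eval {e : NExpr} {v : ℕ} (he : e.Scoped v) :
    PolyBounded v fun s : State K => e.eval s := by
  induction e with
  | const c => exact polyBounded_const v c
  | var x => exact polyBounded_var he
  | get a i h => exact polyBounded_nat _
  | add e₁ e₂ h₁ h₂ => exact (h₁ he.1).add (h₂ he.2)
  | sub e₁ e₂ h₁ h₂ => exact (h₁ he.1).mono fun s => Nat.sub_le _ _
  | mul e₁ e₂ h₁ h₂ => exact (h₁ he.1).mul (h₂ he.2)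
  | div e₁ e₂ h₁ h₂ => exact (h₁ he.1).mono fun s => Nat.div_le_self _ _
  | mod e₁ e₂ h₁ h₂ => exact (h₁ he.1).mono fun s => Nat.mod_le _ _

theorem NExpr.Scoped.polyBounded_cost {e : NExpr} {v : ℕ} (he : e.Scoped v) :
    PolyBounded v fun s : State K => e.cost s := by
  induction e with
  | const c => exact polyBounded_const v (1 + c)
  | var x => exact (polyBounded_const v 1).add (polyBounded_var he)
  | get a i h =>
    exact ((polyBounded_const v 1).add (h he)).add (NExpr.Scoped.polyBounded_eval (e := .get a i) he)
  | add e₁ e₂ h₁ h₂ =>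
    exact (((polyBounded_const v 1).add (h₁ he.1)).add (h₂ he.2)).add
      (NExpr.Scoped.polyBounded_eval (e := .add e₁ e₂) he)
  | sub e₁ e₂ h₁ h₂ =>
    exact (((polyBounded_const v 1).add (h₁ he.1)).add (h₂ he.2)).add
      (NExpr.Scoped.polyBounded_eval (e := .sub e₁ e₂) he)
  | mul e₁ e₂ h₁ h₂ =>
    exact (((polyBounded_const v 1).add (h₁ he.1)).add (h₂ he.2)).add
      (NExpr.Scoped.polyBounded_eval (e := .mul e₁ e₂) he)
  | div e₁ e₂ h₁ h₂ =>
    exact (((polyBounded_const v 1).add (h₁ he.1)).add (h₂ he.2)).add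
      (NExpr.Scoped.polyBounded_eval (e := .div e₁ e₂) he)
  | mod e₁ e₂ h₁ h₂ =>
    exact (((polyBounded_const v 1).add (h₁ he.1)).add (h₂ he.2)).add
      (NExpr.Scoped.polyBounded_eval (e := .mod e₁ e₂) he)

theorem FExpr.Scoped.polyBounded_cost {e : FExpr} {v : ℕ} (he : e.Scoped v) :
    PolyBounded v fun s : State K => e.cost s := by
  induction e with
  | zero => exact polyBounded_const v 1
  | one => exact polyBounded_const v 1
  | get a i => exact (polyBounded_const v 1).add (NExpr.Scoped.polyBounded_cost he)
  | add e₁ e₂ h₁ h₂ => exact ((polyBounded_const v 1).add (h₁ he.1)).add (h₂ he.2)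
  | sub e₁ e₂ h₁ h₂ => exact ((polyBounded_const v 1).add (h₁ he.1)).add (h₂ he.2)
  | mul e₁ e₂ h₁ h₂ => exact ((polyBounded_const v 1).add (h₁ he.1)).add (h₂ he.2)
  | inv e h => exact (polyBounded_const v 1).add (h he)

variable [Field K]

theorem Prog.Scoped.sameNat {P : Prog} {v : ℕ} (hP : P.Scoped v) (s : State K) :
    SameNat v s (P.run s) := by
  induction P generalizing v s with
  | skip => exact SameNat.refl v s
  | seq c₁ c₂ h₁ h₂ => exact (h₁ hP.1 s).trans (h₂ hP.2 _)
  | setVar x e => exact hP.elim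
  | setNat a i e => exact hP.elim
  | setField a i e => exact sameNat_setField v a _ _ s
  | ifLt e₁ e₂ c₁ c₂ h₁ h₂ =>
    simp only [Prog.run]
    split_ifs
    · exact h₁ hP.2.2.1 s
    · exact h₂ hP.2.2.2 s
  | ifZero e c₁ c₂ h₁ h₂ =>
    simp only [Prog.run]
    split_ifs
    · exact h₁ hP.2.1 s
    · exact h₂ hP.2.2 s
  | loop x e c h =>
    obtain ⟨rfl, -, hc⟩ := hP
    exact sameNat_iterate (fun s => h hc s) s _

theorem Prog.Avoids.field_eq {P : Prog} {a : ℕ} (hP : P.Avoids a) (s : State K) :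
    (P.run s).field a = s.field a := by
  induction P generalizing s with
  | skip => rfl
  | seq c₁ c₂ h₁ h₂ => exact (h₂ hP.2 _).trans (h₁ hP.1 s)
  | setVar x e => rfl
  | setNat a i e => rfl
  | setField b i e =>
    have : a ≠ b := fun h => hP h.symm
    simp [Prog.run, State.setField, this]
  | ifLt e₁ e₂ c₁ c₂ h₁ h₂ =>
    simp only [Prog.run]
    split_ifs
    · exact h₁ hP.1 s
    · exact h₂ hP.2 s
  | ifZero e c₁ c₂ h₁ h₂ =>
    simp only [Prog.run]
    split_ifs
    · exact h₁ hP.1 s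
    · exact h₂ hP.2 s
  | loop x e c h =>
    exact iterate_induction (motive := fun _ t => t.field a = s.field a) _ rfl
      (fun k _ t ht => (h hP _).trans ht) _ le_rfl

/-- The running time of a loop, if one round takes a time polynomial in a bound for the natural
numbers. -/
theorem loop_time_le {v : ℕ} {e : NExpr} (he : e.Scoped v) (cb : ℕ) :
    ∃ c, ∀ (b : Prog) T (s : State K), 2 ≤ T → Bounded v T s →
      (∀ k < e.eval s, ∀ T', T ≤ T' → k ≤ T' → b.time ((iterate v b.run s k).setVar v k) ≤ T' ^ cb) →
      (Prog.loop v e b).time s ≤ T ^ c := by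
  obtain ⟨ce, hce⟩ := he.polyBounded_eval (K := K)
  have h1 : PolyBounded v fun s : State K => e.eval s := ⟨ce, hce⟩
  obtain ⟨c, hc⟩ := (polyBounded_const (K := K) v 1).add he.polyBounded_cost
  obtain ⟨c', hc'⟩ := (polyBounded_const (K := K) v 1).add h1
  refine ⟨c + (ce + (c' + (ce + 1) * cb + 1)) + 1, fun b T s hT hs hb => ?_⟩
  have hT1 : 1 ≤ T := by omega
  have hE := hce T s hT hs
  have hC : 1 + e.cost s ≤ T ^ c := hc T s hT hs
  have hC' : 1 + e.eval s ≤ T ^ c' := hc' T s hT hs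
  have hround : ∀ k ∈ Finset.range (e.eval s),
      1 + k + b.time ((iterate v b.run s k).setVar v k) ≤ T ^ (c' + (ce + 1) * cb + 1) := by
    intro k hk
    rw [Finset.mem_range] at hk
    -- The body is charged with the bound `T ^ (ce + 1)`, which dominates the loop variable as well
    -- as `T`, the latter even for `ce = 0`.
    have hk' : k ≤ T ^ (ce + 1) :=
      (hk.le.trans hE).trans (Nat.pow_le_pow_right hT1 (Nat.le_succ _))
    have h3 := hb k hk (T ^ (ce + 1)) (Nat.le_self_pow (by omega) T) hk'
    rw [← pow_mul] at h3
    have h4 : T ^ c' ≤ T ^ (c' + (ce + 1) * cb) := Nat.pow_le_pow_right hT1 (by omega)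
    have h5 : T ^ ((ce + 1) * cb) ≤ T ^ (c' + (ce + 1) * cb) :=
      Nat.pow_le_pow_right hT1 (by omega)
    have h6 : T ^ (c' + (ce + 1) * cb) * 2 ≤ T ^ (c' + (ce + 1) * cb) * T :=
      Nat.mul_le_mul_left _ hT
    rw [pow_succ]
    omega
  have hsum := Finset.sum_le_card_nsmul _ _ _ hround
  rw [Finset.card_range, smul_eq_mul] at hsum
  have h7 := hsum.trans (Nat.mul_le_mul_right (T ^ (c' + (ce + 1) * cb + 1)) hE)
  rw [← pow_add] at h7
  set A := ce + (c' + (ce + 1) * cb + 1)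
  have h8 : T ^ c ≤ T ^ (c + A) := Nat.pow_le_pow_right hT1 (by omega)
  have h9 : T ^ A ≤ T ^ (c + A) := Nat.pow_le_pow_right hT1 (by omega)
  have h10 : T ^ (c + A) * 2 ≤ T ^ (c + A) * T := Nat.mul_le_mul_left _ hT
  rw [pow_succ]
  simp only [Prog.time]
  omega

/-- The running time of a program without computed natural numbers is polynomial in a bound for the
natural numbers that it starts with. -/
theorem Prog.Scoped.polyBounded_time {P : Prog} {v : ℕ} (hP : P.Scoped v) :
    PolyBounded v fun s : State K => P.time s := by
  induction P generalizing v with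
  | skip => exact polyBounded_const v 1
  | seq c₁ c₂ h₁ h₂ =>
    refine (h₁ hP.1).add ?_
    obtain ⟨c, hc⟩ := h₂ hP.2
    exact ⟨c, fun T s hT hs => hc T _ hT (hs.sameNat (hP.1.sameNat s))⟩
  | setVar x e => exact hP.elim
  | setNat a i e => exact hP.elim
  | setField a i e =>
    exact ((polyBounded_const v 1).add hP.1.polyBounded_cost).add hP.2.polyBounded_cost
  | ifLt e₁ e₂ c₁ c₂ h₁ h₂ =>
    refine (((polyBounded_const v 1).add hP.1.polyBounded_cost).add
      hP.2.1.polyBounded_cost).add (((h₁ hP.2.2.1).add (h₂ hP.2.2.2)).mono fun s => ?_)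
    split_ifs <;> omega
  | ifZero e c₁ c₂ h₁ h₂ =>
    refine ((polyBounded_const v 1).add hP.1.polyBounded_cost).add
      (((h₁ hP.2.1).add (h₂ hP.2.2)).mono fun s => ?_)
    split_ifs <;> omega
  | loop x e c h =>
    obtain ⟨rfl, he, hcs⟩ := hP
    obtain ⟨cb, hcb⟩ := h hcs
    obtain ⟨c', hc'⟩ := loop_time_le (K := K) he cb
    refine ⟨c', fun T s hT hs => hc' c T s hT hs fun k hk T' hTT' hkT' => ?_⟩
    refine hcb T' _ (hT.trans hTT') ?_
    have hs' := hs.sameNat (sameNat_iterate (fun s => hcs.sameNat s) s k)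
    refine ⟨fun y hy => ?_, fun a i => (hs'.nat_le a i).trans hTT'⟩
    rcases Nat.lt_succ_iff_lt_or_eq.1 hy with hy | rfl
    · simpa [State.setVar, hy.ne] using (hs'.var_le y hy).trans hTT'
    · simpa [State.setVar] using hkT'

end Time

/-! ### The effect of loops -/

section Loops

variable {K : Type*}

/-- The states agree up to the variables from `v` on and up to the field array `a`. -/
structure SameBut (v a : ℕ) (s t : State K) : Prop extends SameNat v s t where
  field_eq : ∀ b ≠ a, t.field b = s.field b

theorem SameBut.refl (v a : ℕ) (s : State K) : SameBut v a s s :=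
  ⟨SameNat.refl v s, fun _ _ => rfl⟩

/-- A loop whose rounds write to different entries of a field array. -/
theorem iterate_fill {v a N : ℕ} {body : State K → State K} {s : State K} {idx : ℕ → ℕ}
    {val : ℕ → K} (hinj : Set.InjOn idx (Set.Iio N))
    (hbody : ∀ k < N, ∀ t, SameBut v a s t → t.var v = k →
      t.field a (idx k) = s.field a (idx k) → body t = t.setField a (idx k) (val k)) :
    SameBut v a s (iterate v body s N) ∧
      (∀ k < N, (iterate v body s N).field a (idx k) = val k) ∧
      ∀ j, (∀ k < N, idx k ≠ j) → (iterate v body s N).field a j = s.field a j := by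
  have key := iterate_induction (x := v) (body := body) (s := s)
    (motive := fun r t => SameBut v a s t ∧ (∀ k < r, t.field a (idx k) = val k) ∧
      ∀ j, (∀ k < r, idx k ≠ j) → t.field a j = s.field a j) N
    ⟨SameBut.refl v a s, fun k hk => absurd hk (Nat.not_lt_zero k), fun _ _ => rfl⟩ ?_ N le_rfl
  · exact key
  · rintro k hk t ⟨h1, h2, h3⟩
    -- Earlier rounds wrote elsewhere, so a round may still read the original value of the entry
    -- that it overwrites.
    have hne : ∀ k' < k, idx k' ≠ idx k := fun k' hk' e => hk'.ne
      (hinj (show k' < N from hk'.trans hk) (show k < N from hk) e)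
    have hb := hbody k hk (t.setVar v k)
      ⟨h1.toSameNat.trans (sameNat_setVar v k t), h1.field_eq⟩ (by simp [State.setVar])
      (h3 _ hne)
    rw [hb]
    refine ⟨⟨(h1.toSameNat.trans (sameNat_setVar v k t)).trans (sameNat_setField v a _ _ _),
      fun b hba => ?_⟩, fun k' hk' => ?_, fun j hj => ?_⟩
    · rw [← h1.field_eq b hba]
      simp [State.setField, State.setVar, hba]
    · rcases Nat.lt_succ_iff_lt_or_eq.1 hk' with hk' | rfl
      · simpa [State.setField, State.setVar, hne k' hk'] using h2 k' hk'
      · simp [State.setField, State.setVar]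
    · have hjk : j ≠ idx k := (hj k (Nat.lt_succ_self k)).symm
      simpa [State.setField, State.setVar, hjk] using
        h3 j fun k' hk' => hj k' (hk'.trans (Nat.lt_succ_self k))

end Loops

/-! ### The program -/

/-- Half of the degree. -/
def halfE : NExpr := .div (.var 3) (.const 2)

/-- The number of words of half the degree. -/
def sizeE : NExpr := .get 0 halfE

/-- The index of an entry of a square matrix with `sizeE` rows. -/
def entryE (p c : NExpr) : NExpr := .add (.mul p sizeE) c

/-- One round of the elimination: clears the entry with index `v` of the vector in the field
array `3`, with the rows in the field array `2`. -/
def reduceProg (v : ℕ) : Prog :=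
  .seq
    (.ifZero (.get 2 (entryE (.var v) (.var v)))
      (.loop (v + 1) sizeE
        (.setField 2 (entryE (.var v) (.var (v + 1))) (.get 3 (.var (v + 1)))))
      .skip)
    (.seq
      (.setField 4 (.const 0) (.mul (.get 3 (.var v)) (.inv (.get 2 (entryE (.var v) (.var v))))))
      (.loop (v + 1) sizeE
        (.setField 3 (.var (v + 1)) (.sub (.get 3 (.var (v + 1)))
          (.mul (.get 4 (.const 0)) (.get 2 (entryE (.var v) (.var (v + 1)))))))))

/-- Inserts the vector in the field array `3` into the rows in the field array `2`. -/
def insertProg (v : ℕ) : Prog := .loop v sizeE (reduceProg v)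

/-! ### Correctness of the elimination program. -/

section Reduce

variable {K : Type*}

theorem SameNat.eval_sizeE {v : ℕ} {s t : State K} (h : SameNat v s t) (hv : 4 ≤ v) :
    sizeE.eval t = sizeE.eval s := by
  simp [sizeE, halfE, NExpr.eval, h.nat_eq, h.var_eq 3 (by omega)]

variable [Field K]

/-- The rows in the field array `2`. -/
def rowsOf (N : ℕ) (s : State K) : ℕ → ℕ → K :=
  fun p c => if c < N then s.field 2 (p * N + c) else 0

/-- The vector in the field array `3`. -/
def vecOf (N : ℕ) (s : State K) : ℕ → K := fun c => if c < N then s.field 3 c else 0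

theorem entry_inj {N p p' c c' : ℕ} (hc : c < N) (hc' : c' < N)
    (h : p * N + c = p' * N + c') : p = p' ∧ c = c' := by
  have h1 : (p * N + c) / N = p := by
    rw [mul_comm, Nat.mul_add_div (by omega), Nat.div_eq_of_lt hc, add_zero]
  have h2 : (p' * N + c') / N = p' := by
    rw [mul_comm, Nat.mul_add_div (by omega), Nat.div_eq_of_lt hc', add_zero]
  have : p = p' := by rw [← h1, h, h2]
  subst this
  exact ⟨rfl, by omega⟩

theorem copyRow {v N : ℕ} (hv : 4 ≤ v) {s : State K} (hN : sizeE.eval s = N) {p : ℕ}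
    (hp : s.var v = p) :
    let s' := Prog.run (.loop (v + 1) sizeE
        (.setField 2 (entryE (.var v) (.var (v + 1))) (.get 3 (.var (v + 1))))) s
    SameBut (v + 1) 2 s s' ∧ rowsOf N s' = Function.update (rowsOf N s) p (vecOf N s) := by
  intro s'
  have h := iterate_fill (v := v + 1) (a := 2) (N := N)
    (body := Prog.run (.setField 2 (entryE (.var v) (.var (v + 1))) (.get 3 (.var (v + 1)))))
    (s := s) (idx := fun c => p * N + c) (val := fun c => s.field 3 c)
    (fun c _ c' _ e => by simpa using e) (fun k hk t ht hk' _ => by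
      have h1 := ht.toSameNat.eval_sizeE (by omega)
      have h2 := ht.var_eq v (Nat.lt_succ_self v)
      have h3 := ht.field_eq 3 (by omega)
      simp [Prog.run, NExpr.eval, FExpr.eval, entryE, h1, h2, h3, hk', hN, hp])
  have hs' : s' = iterate (v + 1)
      (Prog.run (.setField 2 (entryE (.var v) (.var (v + 1))) (.get 3 (.var (v + 1))))) s N := by
    simp only [s', Prog.run, hN]
  rw [← hs'] at h
  refine ⟨h.1, ?_⟩
  funext r c
  by_cases hc : c < N
  · by_cases hr : r = p
    · subst hr
      simpa [rowsOf, vecOf, hc] using h.2.1 c hc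
    · have := h.2.2 (r * N + c) fun k hk e => hr (entry_inj hk hc e).1.symm
      simpa [rowsOf, vecOf, hc, hr] using this
  · by_cases hr : r = p
    · subst hr
      simp [rowsOf, vecOf, hc]
    · simp [rowsOf, hc, hr]

/-- The factor is held in the field array `4`, since the entry of the vector from which it is
computed changes during the loop. -/
theorem subtractRow {v N : ℕ} (hv : 4 ≤ v) {s : State K} (hN : sizeE.eval s = N) {p : ℕ}
    (hp : s.var v = p) :
    let s' := Prog.run (.loop (v + 1) sizeE
        (.setField 3 (.var (v + 1)) (.sub (.get 3 (.var (v + 1)))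
          (.mul (.get 4 (.const 0)) (.get 2 (entryE (.var v) (.var (v + 1)))))))) s
    SameBut (v + 1) 3 s s' ∧ vecOf N s' = vecOf N s - s.field 4 0 • rowsOf N s p := by
  intro s'
  set b : Prog := .setField 3 (.var (v + 1)) (.sub (.get 3 (.var (v + 1)))
          (.mul (.get 4 (.const 0)) (.get 2 (entryE (.var v) (.var (v + 1)))))) with hb
  have h := iterate_fill (v := v + 1) (a := 3) (N := N) (body := b.run)
    (s := s) (idx := fun c => c)
    (val := fun c => s.field 3 c - s.field 4 0 * s.field 2 (p * N + c))
    (fun c _ c' _ e => e) (fun k hk t ht hk' hf => by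
      have h1 := ht.toSameNat.eval_sizeE (by omega)
      have h2 := ht.var_eq v (Nat.lt_succ_self v)
      have h3 := ht.field_eq 2 (by omega)
      have h4 := ht.field_eq 4 (by omega)
      simp [hb, Prog.run, NExpr.eval, FExpr.eval, entryE, h1, h2, h3, h4, hk', hN, hp, hf])
  have hs' : s' = iterate (v + 1) b.run s N := by
    rw [← hN]
    rfl
  rw [← hs'] at h
  refine ⟨h.1, ?_⟩
  funext c
  by_cases hc : c < N
  · simpa [rowsOf, vecOf, hc] using h.2.1 c hc
  · simp [rowsOf, vecOf, hc]

theorem reduceProg_run {v N : ℕ} (hv : 4 ≤ v) {s : State K} (hN : sizeE.eval s = N) {p : ℕ}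
    (hp : s.var v = p) (hpN : p < N) :
    rowsOf N ((reduceProg v).run s) = reduceRows (rowsOf N s) (vecOf N s) p ∧
      vecOf N ((reduceProg v).run s) = reduceVec (rowsOf N s) (vecOf N s) p := by
  set c₁ : Prog := .ifZero (.get 2 (entryE (.var v) (.var v)))
      (.loop (v + 1) sizeE
        (.setField 2 (entryE (.var v) (.var (v + 1))) (.get 3 (.var (v + 1)))))
      .skip with hc₁
  have h1 : SameBut (v + 1) 2 s (c₁.run s) ∧
      rowsOf N (c₁.run s) = reduceRows (rowsOf N s) (vecOf N s) p := by
    have hdiag : FExpr.eval s (.get 2 (entryE (.var v) (.var v))) = rowsOf N s p p := by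
      simp [FExpr.eval, entryE, NExpr.eval, hN, hp, rowsOf, hpN]
    rw [hc₁, Prog.run, hdiag]
    split_ifs with h0
    · have := copyRow hv hN hp
      simpa only [reduceRows, pivotRow, h0, if_true] using this
    · refine ⟨SameBut.refl _ _ s, ?_⟩
      simp [reduceRows, pivotRow, h0, Prog.run]
  obtain ⟨hsame, hrows⟩ := h1
  set s₁ := c₁.run s with hs₁
  have hvec : vecOf N s₁ = vecOf N s := by
    funext c
    simp [vecOf, hsame.field_eq 3 (by omega)]
  have hN₁ : sizeE.eval s₁ = N := (hsame.toSameNat.eval_sizeE (by omega)).trans hN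
  have hp₁ : s₁.var v = p := (hsame.var_eq v (Nat.lt_succ_self v)).trans hp
  set f : K := vecOf N s p * (pivotRow (rowsOf N s) (vecOf N s) p p)⁻¹ with hf
  set s₂ := s₁.setField 4 0 f with hs₂
  have hrun₂ : Prog.run (.setField 4 (.const 0)
      (.mul (.get 3 (.var v)) (.inv (.get 2 (entryE (.var v) (.var v)))))) s₁ = s₂ := by
    have e1 : s₁.field 3 p = vecOf N s p := by
      rw [← hvec]
      simp [vecOf, hpN]
    have e2 : s₁.field 2 (p * N + p) = pivotRow (rowsOf N s) (vecOf N s) p p := by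
      have := congrFun (congrFun hrows p) p
      simpa [rowsOf, hpN, reduceRows] using this
    simp [Prog.run, FExpr.eval, NExpr.eval, entryE, hN₁, hp₁, e1, e2, hs₂, hf]
  have hrows₂ : rowsOf N s₂ = rowsOf N s₁ := by
    funext r c
    simp [rowsOf, hs₂, State.setField]
  have hvec₂ : vecOf N s₂ = vecOf N s₁ := by
    funext c
    simp [vecOf, hs₂, State.setField]
  have hN₂ : sizeE.eval s₂ = N :=
    ((sameNat_setField 4 4 0 f s₁).eval_sizeE le_rfl).trans hN₁
  have h3 := subtractRow hv hN₂ (p := p) hp₁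
  have hrun : (reduceProg v).run s = Prog.run (.loop (v + 1) sizeE
        (.setField 3 (.var (v + 1)) (.sub (.get 3 (.var (v + 1)))
          (.mul (.get 4 (.const 0)) (.get 2 (entryE (.var v) (.var (v + 1)))))))) s₂ := by
    rw [← hrun₂, hs₁, hc₁]
    rfl
  rw [← hrun] at h3
  obtain ⟨hsame₃, hvec₃⟩ := h3
  constructor
  · rw [← hrows, ← hrows₂]
    funext r c
    simp [rowsOf, hsame₃.field_eq 2 (by omega)]
  · have e4 : s₂.field 4 0 = f := by simp [hs₂, State.setField]
    have e5 : reduceRows (rowsOf N s) (vecOf N s) p p = pivotRow (rowsOf N s) (vecOf N s) p := by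
      simp [reduceRows]
    rw [hvec₃, hvec₂, hvec, e4, hrows₂, hrows, e5]
    rfl

theorem scoped_halfE {v : ℕ} (hv : 4 ≤ v) : halfE.Scoped v := ⟨by simp only [NExpr.Scoped]; omega, trivial⟩

theorem scoped_sizeE {v : ℕ} (hv : 4 ≤ v) : sizeE.Scoped v := scoped_halfE hv

theorem scoped_reduceProg {v : ℕ} (hv : 4 ≤ v) : (reduceProg v).Scoped (v + 1) := by
  simp only [reduceProg, entryE, Prog.Scoped, FExpr.Scoped, NExpr.Scoped]
  have h1 := scoped_sizeE (v := v + 1) (by omega)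
  have h2 := scoped_sizeE (v := v + 1 + 1) (by omega)
  simp [h1, h2]

theorem scoped_insertProg {v : ℕ} (hv : 4 ≤ v) : (insertProg v).Scoped v :=
  ⟨rfl, scoped_sizeE hv, scoped_reduceProg hv⟩

theorem avoids_insertProg (v a : ℕ) (ha : a < 2) : (insertProg v).Avoids a := by
  refine ⟨⟨?_, trivial⟩, ?_, ?_⟩ <;> change _ ≠ a <;> omega

/-- The number of basis vectors that `x` may add. -/
def nonzeroCount (x : ℕ → K) : ℕ := if x = 0 then 0 else 1

/-- The change of the rows by the insertion of the vectors in `X`, at most `c` of which are nonzero,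
with no change to the variables less than `v` and to the input and output. -/
structure Grows (N v : ℕ) (X : Set (ℕ → K)) (c : ℕ) (s t : State K) : Prop
    extends SameNat v s t where
  field_eq : ∀ a < 2, t.field a = s.field a
  echelon : Echelon N (rowsOf N s) → Echelon N (rowsOf N t)
  span_le : Echelon N (rowsOf N s) → rowSpan N (rowsOf N s) ≤ rowSpan N (rowsOf N t)
  subset : Echelon N (rowsOf N s) → X ⊆ rowSpan N (rowsOf N t)
  card_le : Echelon N (rowsOf N s) →
    (pivots N (rowsOf N t)).card ≤ (pivots N (rowsOf N s)).card + c

theorem grows_of_rowsOf_eq {N v : ℕ} {s t : State K} (h : SameNat v s t)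
    (hf : ∀ a < 2, t.field a = s.field a) (hr : rowsOf N t = rowsOf N s) : Grows N v ∅ 0 s t :=
  ⟨h, hf, fun he => by rwa [hr], fun _ => by rw [hr], fun _ => Set.empty_subset _,
    fun _ => by rw [hr, add_zero]⟩

theorem Grows.trans {N v : ℕ} {X Y : Set (ℕ → K)} {c e : ℕ} {s t u : State K}
    (h : Grows N v X c s t) (h' : Grows N v Y e t u) : Grows N v (X ∪ Y) (c + e) s u :=
  ⟨h.toSameNat.trans h'.toSameNat, fun a ha => (h'.field_eq a ha).trans (h.field_eq a ha),
    fun he => h'.echelon (h.echelon he),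
    fun he => (h.span_le he).trans (h'.span_le (h.echelon he)),
    fun he => Set.union_subset ((h.subset he).trans (h'.span_le (h.echelon he)))
      (h'.subset (h.echelon he)), fun he => by
      have := h.card_le he
      have := h'.card_le (h.echelon he)
      omega⟩

theorem Grows.mono {N v w : ℕ} {X Y : Set (ℕ → K)} {c e : ℕ} {s t : State K}
    (h : Grows N w X c s t) (hvw : v ≤ w) (hY : Y ⊆ X) (hc : c ≤ e) : Grows N v Y e s t :=
  ⟨h.toSameNat.mono hvw, h.field_eq, h.echelon, h.span_le, fun he => hY.trans (h.subset he),
    fun he => (h.card_le he).trans (Nat.add_le_add_left hc _)⟩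

theorem grows_setVar (N v k : ℕ) (s : State K) : Grows N v ∅ 0 s (s.setVar v k) :=
  grows_of_rowsOf_eq (sameNat_setVar v k s) (fun _ _ => rfl) rfl

theorem grows_iterate {N v L : ℕ} {body : State K → State K} {s : State K}
    {X : ℕ → Set (ℕ → K)} {c : ℕ → ℕ}
    (hbody : ∀ k < L, ∀ t, SameNat v s t → (∀ a < 2, t.field a = s.field a) → t.var v = k →
      Grows N (v + 1) (X k) (c k) t (body t)) :
    Grows N v (⋃ k ∈ Set.Iio L, X k) (∑ k ∈ Finset.range L, c k) s (iterate v body s L) := by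
  refine iterate_induction (x := v) (body := body) (s := s)
    (motive := fun r t => Grows N v (⋃ k ∈ Set.Iio r, X k) (∑ k ∈ Finset.range r, c k) s t) L
    ?_ ?_ L le_rfl
  · simpa using grows_of_rowsOf_eq (N := N) (SameNat.refl v s) (fun _ _ => rfl) rfl
  · intro k hk t ht
    have h1 := ht.trans (grows_setVar N v k t)
    have h2 := hbody k hk (t.setVar v k) h1.toSameNat h1.field_eq (by simp [State.setVar])
    refine (h1.trans (h2.mono (Nat.le_succ v) le_rfl le_rfl)).mono le_rfl ?_ ?_
    · intro x hx
      obtain ⟨j, hj, hxj⟩ := Set.mem_iUnion₂.1 hx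
      rcases Nat.lt_succ_iff_lt_or_eq.1 hj with hj | rfl
      · exact Or.inl (Or.inl (Set.mem_iUnion₂.2 ⟨j, hj, hxj⟩))
      · exact Or.inr hxj
    · rw [Finset.sum_range_succ, add_zero]

/-- After `r` rounds the first `r` entries of the vector are zero. After `N` rounds nothing is left
of it, so the original vector lies in the new row span, and the new pivots number at most one, or
none for a zero vector. -/
theorem insertProg_run {v N : ℕ} (hv : 4 ≤ v) {s : State K} (hN : sizeE.eval s = N) :
    Grows N v {vecOf N s} (nonzeroCount (vecOf N s)) s ((insertProg v).run s) := by
  have hsame := (scoped_insertProg hv).sameNat s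
  have hfield : ∀ a < 2, ((insertProg v).run s).field a = s.field a := fun a ha =>
    (avoids_insertProg v a ha).field_eq s
  have key : Echelon N (rowsOf N s) → Echelon N (rowsOf N ((insertProg v).run s)) ∧
      (∀ c < N, vecOf N ((insertProg v).run s) c = 0) ∧
      ReducesTo N (rowsOf N s) (vecOf N s) (rowsOf N ((insertProg v).run s))
        (vecOf N ((insertProg v).run s)) := by
    intro he
    have hrun : (insertProg v).run s = iterate v (reduceProg v).run s N := by
      simp only [insertProg, Prog.run, hN]
    have := iterate_induction (x := v) (body := (reduceProg v).run) (s := s)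
      (motive := fun r t => SameNat v s t ∧ Echelon N (rowsOf N t) ∧ (∀ c < r, vecOf N t c = 0) ∧
        ReducesTo N (rowsOf N s) (vecOf N s) (rowsOf N t) (vecOf N t)) N
      ⟨SameNat.refl v s, he, fun c hc => absurd hc (Nat.not_lt_zero c), ReducesTo.refl _ _ _⟩ ?_
      N le_rfl
    · rw [hrun]
      exact this.2
    · rintro k hk t ⟨h1, h2, h3, h4⟩
      have h5 := h1.trans (sameNat_setVar v k t)
      have h6 := reduceProg_run hv (s := t.setVar v k) (p := k) (N := N)
        ((h5.eval_sizeE hv).trans hN) (by simp [State.setVar]) hk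
      rw [h6.1, h6.2]
      exact ⟨h5.trans (((scoped_reduceProg hv).sameNat _).mono (Nat.le_succ v)), h2.reduceRows h3,
        h2.reduceVec_eq_zero hk h3, h4.trans (reducesTo_reduce hk)⟩
  have hzero : Echelon N (rowsOf N s) → vecOf N ((insertProg v).run s) = 0 := fun he => by
    funext c
    by_cases hc : c < N
    · exact (key he).2.1 c hc
    · simp [vecOf, hc]
  refine ⟨hsame, hfield, fun he => (key he).1, fun he => (key he).2.2.span_le, fun he => ?_,
    fun he => ?_⟩
  · have := (key he).2.2.sub_mem
    rw [hzero he, sub_zero] at this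
    exact Set.singleton_subset_iff.2 this
  · have := (key he).2.2.card_le
    rw [hzero he, if_pos rfl, add_zero] at this
    exact this

end Reduce

/-- The length of the words at which a help polynomial is read. -/
def partE : NExpr := .add (.sub halfE (.var 5)) (.add (.var 6) (.const 1))

/-- The number of the last parts of the row words. -/
def tailE : NExpr := .get 0 (.sub halfE (.var 5))

/-- The position in the input of a coefficient of a help polynomial. -/
def inputE : NExpr :=
  .add
    (.add
      (.add (.mul (.var 7) (.get 1 (.add (.var 2) (.const 1)))) (.get 1 partE))
      (.mul (.mod (.var 9) tailE) (.get 0 (.add (.var 6) (.const 1)))))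
    (.div (.var 4) (.get 0 (.sub halfE (.add (.var 6) (.const 1)))))

/-- Writes the vector with parameters `4`, …, `8` into the field array `3`. -/
def fillProg : Prog :=
  .loop 9 sizeE
    (.ifLt (.div (.var 9) tailE) (.var 8) (.setField 3 (.var 9) .zero)
      (.ifLt (.var 8) (.div (.var 9) tailE) (.setField 3 (.var 9) .zero)
        (.setField 3 (.var 9) (.get 0 inputE))))

/-- Inserts all vectors that belong to the column `4`. -/
def genProg : Prog :=
  .loop 5 halfE (.loop 6 halfE (.loop 7 (.var 1) (.loop 8 (.get 0 (.var 5))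
    (.ifLt partE (.add (.var 2) (.const 1)) (.seq fillProg (insertProg 9)) .skip))))

/-- Writes the indicator vector of the unused rows into the field array `3`. -/
def indicatorProg : Prog :=
  .loop 5 sizeE (.ifZero (.get 2 (entryE (.var 5) (.var 5)))
    (.setField 3 (.var 5) .one) (.setField 3 (.var 5) .zero))

/-- The position in the output of the coefficient in row `p` and column `q`. -/
def outputE (p q : NExpr) : NExpr := .add (.get 1 (.var 3)) (entryE p q)

/-- Writes the vector in the field array `3` into the column `4` of the output. -/
def outputProg : Prog :=
  .loop 5 sizeE (.setField 1 (outputE (.var 5) (.var 4)) (.get 3 (.var 5)))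

/-- Computes the column `4` of the output. -/
def columnProg : Prog :=
  .seq genProg (.seq indicatorProg (.seq outputProg (insertProg 5)))

/-- Computes the output from the input and the tables of powers and offsets. -/
def mainProg : Prog :=
  .seq (.loop 4 sizeE columnProg)
    (.setField 1 (outputE (.const 0) (.sub sizeE (.const 1))) .one)

theorem scoped_mainProg : mainProg.Scoped 4 := by
  have h1 := scoped_insertProg (v := 9) (by omega)
  have h2 := scoped_insertProg (v := 5) (by omega)
  simp [mainProg, columnProg, genProg, fillProg, indicatorProg, outputProg, outputE, inputE, tailE,
    partE, entryE, sizeE, halfE, Prog.Scoped, FExpr.Scoped, NExpr.Scoped, h1, h2]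

/-! ### Correctness of the column-by-column construction of the output. -/

section Main

variable {K : Type*}

/-- The state holds the parameters and the tables of powers and offsets. -/
structure Ready (n m D d : ℕ) (s : State K) : Prop where
  var_one : s.var 1 = m
  var_two : s.var 2 = D
  var_three : s.var 3 = d
  pow : ∀ i ≤ D + d, s.nat 0 i = n ^ i
  off : ∀ i ≤ D + d, s.nat 1 i = offset n i

theorem Ready.sameNat {n m D d v : ℕ} {s t : State K} (hs : Ready n m D d s) (h : SameNat v s t)
    (hv : 4 ≤ v) : Ready n m D d t :=
  ⟨(h.var_eq 1 (by omega)).trans hs.var_one, (h.var_eq 2 (by omega)).trans hs.var_two,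
    (h.var_eq 3 (by omega)).trans hs.var_three, fun i hi => by rw [h.nat_eq]; exact hs.pow i hi,
    fun i hi => by rw [h.nat_eq]; exact hs.off i hi⟩

theorem Ready.eval_halfE {n m D d : ℕ} {s : State K} (hs : Ready n m D d s) :
    halfE.eval s = d / 2 := by
  simp [halfE, NExpr.eval, hs.var_three]

theorem Ready.eval_sizeE {n m D d : ℕ} {s : State K} (hs : Ready n m D d s) :
    sizeE.eval s = n ^ (d / 2) := by
  rw [sizeE, NExpr.eval, hs.eval_halfE, hs.pow _ (by omega)]

variable [Field K]

/-- The part of a column, in rows that start with a given word of length `k`, of a product of two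
words and a help polynomial, where the last `d / 2 - (l + 1)` letters of the column word come from
the second word. -/
def genVec (inp : ℕ → K) (n D d q k l j a : ℕ) : ℕ → K := fun p =>
  if p < n ^ (d / 2) then
    if p / n ^ (d / 2 - k) = a then
      inp (j * offset n (D + 1) + offset n (d / 2 - k + (l + 1)) +
        p % n ^ (d / 2 - k) * n ^ (l + 1) + q / n ^ (d / 2 - (l + 1)))
    else 0
  else 0

/-- All vectors `genVec` for a column. -/
def genSet (inp : ℕ → K) (n m D d q : ℕ) : Set (ℕ → K) :=
  ⋃ k ∈ Set.Iio (d / 2), ⋃ l ∈ Set.Iio (d / 2), ⋃ j ∈ Set.Iio m, ⋃ a ∈ Set.Iio (n ^ k),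
    if d / 2 - k + (l + 1) < D + 1 then {genVec inp n D d q k l j a} else ∅

/-- The number of nonzero vectors `genVec` for a column. -/
def genCount (inp : ℕ → K) (n m D d q : ℕ) : ℕ :=
  ∑ k ∈ Finset.range (d / 2), ∑ l ∈ Finset.range (d / 2), ∑ j ∈ Finset.range m,
    ∑ a ∈ Finset.range (n ^ k),
      if d / 2 - k + (l + 1) < D + 1 then nonzeroCount (genVec inp n D d q k l j a) else 0

theorem fillProg_run {n m D d q k l j a : ℕ} {inp : ℕ → K} (hd : 2 ≤ d) {s : State K}
    (hs : Ready n m D d s) (hin : s.field 0 = inp) (h4 : s.var 4 = q) (h5 : s.var 5 = k)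
    (h6 : s.var 6 = l) (h7 : s.var 7 = j) (h8 : s.var 8 = a) (hl : l < d / 2) :
    SameBut 9 3 s (fillProg.run s) ∧
      vecOf (n ^ (d / 2)) (fillProg.run s) = genVec inp n D d q k l j a := by
  set N := n ^ (d / 2) with hN
  set b : Prog := .ifLt (.div (.var 9) tailE) (.var 8) (.setField 3 (.var 9) .zero)
      (.ifLt (.var 8) (.div (.var 9) tailE) (.setField 3 (.var 9) .zero)
        (.setField 3 (.var 9) (.get 0 inputE))) with hb
  have h := iterate_fill (v := 9) (a := 3) (N := N) (body := b.run) (s := s) (idx := fun c => c)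
    (val := genVec inp n D d q k l j a) (fun c _ c' _ e => e) (fun p hp t ht hp' _ => by
      have hr := hs.sameNat ht.toSameNat (by omega)
      have e4 := (ht.var_eq 4 (by omega)).trans h4
      have e5 := (ht.var_eq 5 (by omega)).trans h5
      have e6 := (ht.var_eq 6 (by omega)).trans h6
      have e7 := (ht.var_eq 7 (by omega)).trans h7
      have e8 := (ht.var_eq 8 (by omega)).trans h8
      have e0 := (ht.field_eq 0 (by omega)).trans hin
      have et : tailE.eval t = n ^ (d / 2 - k) := by
        simp only [tailE, NExpr.eval, hr.eval_halfE, e5]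
        exact hr.pow _ (by omega)
      have ep : partE.eval t = d / 2 - k + (l + 1) := by
        simp only [partE, NExpr.eval, hr.eval_halfE, e5, e6]
      have ei : inputE.eval t = j * offset n (D + 1) + offset n (d / 2 - k + (l + 1)) +
          p % n ^ (d / 2 - k) * n ^ (l + 1) + q / n ^ (d / 2 - (l + 1)) := by
        simp only [inputE, NExpr.eval, hr.eval_halfE, et, ep, e4, e6, e7, hp', hr.var_two]
        rw [hr.off (D + 1) (by omega), hr.off (d / 2 - k + (l + 1)) (by omega),
          hr.pow (l + 1) (by omega), hr.pow (d / 2 - (l + 1)) (by omega)]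
      simp only [hb, Prog.run, NExpr.eval, FExpr.eval, et, ei, e8, hp', e0, genVec, ← hN, hp,
        if_true]
      -- Programs can only test `<` on natural numbers; equality of the leading part with `a` is
      -- what two comparisons leave over.
      rcases lt_trichotomy (p / n ^ (d / 2 - k)) a with h | h | h
      · simp [h, h.ne]
      · simp [h]
      · simp [h, h.ne', not_lt_of_gt h])
  have hrun : fillProg.run s = iterate 9 b.run s N := by
    rw [hN, ← hs.eval_sizeE]
    rfl
  rw [← hrun] at h
  refine ⟨h.1, ?_⟩
  funext c
  by_cases hc : c < N
  · simpa [vecOf, hc] using h.2.1 c hc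
  · simp [vecOf, hc, genVec, ← hN]

theorem grows_of_sameBut {N v : ℕ} {s t : State K} (h : SameBut v 3 s t) : Grows N v ∅ 0 s t :=
  grows_of_rowsOf_eq h.toSameNat (fun a ha => h.field_eq a (by omega)) (by
    funext p c
    simp [rowsOf, h.field_eq 2 (by omega)])

/-- The nested loops run over all parameters of `genVec`. The test against `D + 1` skips words
longer than `D`, whose positions would fall outside the block of `h j` in the input. -/
theorem genProg_run {n m D d q : ℕ} {inp : ℕ → K} (hd : 2 ≤ d) {s : State K}
    (hs : Ready n m D d s) (hin : s.field 0 = inp) (h4 : s.var 4 = q) :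
    Grows (n ^ (d / 2)) 5 (genSet inp n m D d q) (genCount inp n m D d q) s (genProg.run s) := by
  rw [genProg, Prog.run, hs.eval_halfE]
  refine grows_iterate fun k hk s₅ hs₅ hf₅ h5 => ?_
  have r5 := hs.sameNat hs₅ (by omega)
  rw [Prog.run, r5.eval_halfE]
  refine grows_iterate fun l hl s₆ hs₆ hf₆ h6 => ?_
  have r6 := r5.sameNat hs₆ (by omega)
  rw [Prog.run, NExpr.eval, r6.var_one]
  refine grows_iterate fun j _ s₇ hs₇ hf₇ h7 => ?_
  have r7 := r6.sameNat hs₇ (by omega)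
  have e5 : s₇.var 5 = k :=
    ((hs₇.var_eq 5 (by omega)).trans (hs₆.var_eq 5 (by omega))).trans h5
  rw [Prog.run, NExpr.eval, NExpr.eval, e5, r7.pow k (by omega)]
  refine grows_iterate fun a _ s₈ hs₈ hf₈ h8 => ?_
  have r8 := r7.sameNat hs₈ (by omega)
  have e7 : s₈.var 7 = j := (hs₈.var_eq 7 (by omega)).trans h7
  have e6 : s₈.var 6 = l :=
    ((hs₈.var_eq 6 (by omega)).trans (hs₇.var_eq 6 (by omega))).trans h6
  have e5 : s₈.var 5 = k := (hs₈.var_eq 5 (by omega)).trans e5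
  have e4 : s₈.var 4 = q :=
    ((((hs₈.var_eq 4 (by omega)).trans (hs₇.var_eq 4 (by omega))).trans
      (hs₆.var_eq 4 (by omega))).trans (hs₅.var_eq 4 (by omega))).trans h4
  have e0 : s₈.field 0 = inp :=
    ((((hf₈ 0 (by omega)).trans (hf₇ 0 (by omega))).trans (hf₆ 0 (by omega))).trans
      (hf₅ 0 (by omega))).trans hin
  have ep : partE.eval s₈ = d / 2 - k + (l + 1) := by
    simp only [partE, NExpr.eval, r8.eval_halfE, e5, e6]
  have eD : NExpr.eval s₈ (.add (.var 2) (.const 1)) = D + 1 := by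
    simp only [NExpr.eval, r8.var_two]
  rw [Prog.run, ep, eD]
  split_ifs
  · obtain ⟨g1, g2⟩ := fillProg_run hd r8 e0 e4 e5 e6 e7 h8 hl
    have g3 := insertProg_run (v := 9) (N := n ^ (d / 2)) (by omega) (s := fillProg.run s₈)
      (r8.sameNat g1.toSameNat (by omega)).eval_sizeE
    rw [g2] at g3
    refine ((grows_of_sameBut g1).trans g3).mono le_rfl ?_ ?_
    · simp
    · simp
  · exact grows_of_rowsOf_eq (SameNat.refl _ _) (fun _ _ => rfl) rfl

/-- A column of the output. -/
def outCol (N o : ℕ) (s : State K) (q : ℕ) : ℕ → K := fun p =>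
  if p < N then s.field 1 (o + (p * N + q)) else 0

theorem indicatorProg_run {n m D d : ℕ} {s : State K} (hs : Ready n m D d s) :
    SameBut 5 3 s (indicatorProg.run s) ∧
      vecOf (n ^ (d / 2)) (indicatorProg.run s) = fun c => if c < n ^ (d / 2) then
        if rowsOf (n ^ (d / 2)) s c c = 0 then (1 : K) else 0 else 0 := by
  set N := n ^ (d / 2) with hN
  set b : Prog := .ifZero (.get 2 (entryE (.var 5) (.var 5)))
    (.setField 3 (.var 5) .one) (.setField 3 (.var 5) .zero) with hb
  have h := iterate_fill (v := 5) (a := 3) (N := N) (body := b.run) (s := s) (idx := fun c => c)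
    (val := fun c => if rowsOf N s c c = 0 then (1 : K) else 0) (fun c _ c' _ e => e)
    (fun p hp t ht hp' _ => by
      have hr := hs.sameNat ht.toSameNat (by omega)
      have e2 := ht.field_eq 2 (by omega)
      simp only [hb, Prog.run, NExpr.eval, FExpr.eval, entryE, hp', e2, hr.eval_sizeE, ← hN,
        rowsOf, hp, if_true]
      split_ifs <;> rfl)
  have hrun : indicatorProg.run s = iterate 5 b.run s N := by
    rw [hN, ← hs.eval_sizeE]
    rfl
  rw [← hrun] at h
  refine ⟨h.1, ?_⟩
  funext c
  by_cases hc : c < N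
  · simpa [vecOf, hc] using h.2.1 c hc
  · simp [vecOf, hc]

theorem outputProg_run {n m D d q : ℕ} {s : State K} (hs : Ready n m D d s) (h4 : s.var 4 = q) :
    SameBut 5 1 s (outputProg.run s) ∧
      outCol (n ^ (d / 2)) (offset n d) (outputProg.run s) q = vecOf (n ^ (d / 2)) s ∧
      ∀ i, (∀ p < n ^ (d / 2), offset n d + (p * n ^ (d / 2) + q) ≠ i) →
        (outputProg.run s).field 1 i = s.field 1 i := by
  set N := n ^ (d / 2) with hN
  set b : Prog := .setField 1 (outputE (.var 5) (.var 4)) (.get 3 (.var 5)) with hb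
  have h := iterate_fill (v := 5) (a := 1) (N := N) (body := b.run) (s := s)
    (idx := fun p => offset n d + (p * N + q)) (val := fun p => s.field 3 p)
    (fun c hc c' hc' e => by
      have hN0 : 0 < N := lt_of_le_of_lt (Nat.zero_le c) hc
      have e' : c * N = c' * N := by
        simp only at e
        omega
      exact Nat.eq_of_mul_eq_mul_right hN0 e')
    (fun p hp t ht hp' _ => by
      have hr := hs.sameNat ht.toSameNat (by omega)
      have e3 := ht.field_eq 3 (by omega)
      have e4 := (ht.var_eq 4 (by omega)).trans h4
      simp only [hb, Prog.run, NExpr.eval, FExpr.eval, entryE, outputE, hp', e3, e4, hr.eval_sizeE,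
        ← hN, hr.var_three]
      rw [hr.off d (by omega)])
  have hrun : outputProg.run s = iterate 5 b.run s N := by
    rw [hN, ← hs.eval_sizeE]
    rfl
  rw [← hrun] at h
  refine ⟨h.1, ?_, h.2.2⟩
  funext c
  by_cases hc : c < N
  · simpa [vecOf, outCol, hc] using h.2.1 c hc
  · simp [vecOf, outCol, hc]

/-- The effect of the computation of one column. -/
theorem columnProg_run {n m D d q : ℕ} {inp : ℕ → K} (hd : 2 ≤ d) {s : State K}
    (hs : Ready n m D d s) (hin : s.field 0 = inp) (h4 : s.var 4 = q)
    (he : Echelon (n ^ (d / 2)) (rowsOf (n ^ (d / 2)) s)) {N : ℕ} (hN : N = n ^ (d / 2)) :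
    let t := columnProg.run s
    SameNat 5 s t ∧ t.field 0 = inp ∧ Echelon N (rowsOf N t) ∧
      (∀ i, (∀ p < N, offset n d + (p * N + q) ≠ i) → t.field 1 i = s.field 1 i) ∧
      (pivots N (rowsOf N t)).card ≤ (pivots N (rowsOf N s)).card + genCount inp n m D d q + 1 ∧
      outCol N (offset n d) t q ∈ rowSpan N (rowsOf N t) ∧
      ∃ V : Submodule K (ℕ → K), rowSpan N (rowsOf N s) ≤ V ∧ V ≤ rowSpan N (rowsOf N t) ∧
        genSet inp n m D d q ⊆ V ∧
        ((pivots N (rowsOf N s)).card + genCount inp n m D d q < N →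
          outCol N (offset n d) t q ∉ V) := by
  subst hN
  intro t
  set N := n ^ (d / 2) with hN
  have g1 := genProg_run hd hs hin h4
  set s₁ := genProg.run s with hs₁
  have r1 := hs.sameNat g1.toSameNat (by omega)
  obtain ⟨b2, v2⟩ := indicatorProg_run r1
  set s₂ := indicatorProg.run s₁ with hs₂
  have r2 := r1.sameNat b2.toSameNat (by omega)
  have q2 : s₂.var 4 = q :=
    ((b2.var_eq 4 (by omega)).trans (g1.var_eq 4 (by omega))).trans h4
  obtain ⟨b3, o3, f3⟩ := outputProg_run r2 q2
  set s₃ := outputProg.run s₂ with hs₃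
  have r3 := r2.sameNat b3.toSameNat (by omega)
  have g4 := insertProg_run (v := 5) (N := N) (by omega) (s := s₃) r3.eval_sizeE
  have ht : t = (insertProg 5).run s₃ := rfl
  rw [← ht] at g4
  -- The intermediate space `V` is the row span of `s₁`, after the insertion of the vectors `genVec`
  -- and before that of the new column; writing the indicator and the output does not touch it.
  have hrows : rowsOf N s₃ = rowsOf N s₁ := by
    funext p c
    simp [rowsOf, b3.field_eq 2 (by omega), b2.field_eq 2 (by omega)]
  have hvec : vecOf N s₃ = vecOf N s₂ := by
    funext c
    simp [vecOf, b3.field_eq 3 (by omega)]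
  have hout : outCol N (offset n d) t q = vecOf N s₃ := by
    rw [hvec, ← o3]
    funext p
    simp [outCol, g4.field_eq 1 (by omega), hN]
  have he1 := g1.echelon he
  have he3 : Echelon N (rowsOf N s₃) := by rwa [hrows]
  refine ⟨((g1.toSameNat.trans b2.toSameNat).trans b3.toSameNat).trans g4.toSameNat, ?_,
    g4.echelon he3, fun i hi => ?_, ?_, ?_, rowSpan N (rowsOf N s₁), g1.span_le he, ?_,
    g1.subset he, fun hlt => ?_⟩
  · rw [g4.field_eq 0 (by omega), b3.field_eq 0 (by omega), b2.field_eq 0 (by omega),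
      g1.field_eq 0 (by omega), hin]
  · rw [g4.field_eq 1 (by omega), f3 i hi, b2.field_eq 1 (by omega), g1.field_eq 1 (by omega)]
  · have h1 := g4.card_le he3
    have h2 : (pivots N (rowsOf N s₁)).card ≤
        (pivots N (rowsOf N s)).card + genCount inp n m D d q := g1.card_le he
    have h3 : nonzeroCount (vecOf N s₃) ≤ 1 := by
      rw [nonzeroCount]
      split_ifs <;> omega
    rw [hrows] at h1
    omega
  · rw [hout]
    exact Set.singleton_subset_iff.1 (g4.subset he3)
  · rw [← hrows]
    exact g4.span_le he3
  · rw [hout, hvec, v2]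
    exact he1.indicator_notMem (lt_of_le_of_lt (g1.card_le he) hlt)

/-- The properties of the output that lead to a lower bound: the columns are linearly independent
modulo the span of the vectors `genVec`, in a way that takes the columns one after the other. -/
theorem mainProg_run {n m D d δ N : ℕ} {inp : ℕ → K} (hd : 2 ≤ d) (hn : 1 ≤ n) {s : State K}
    (hs : Ready n m D d s) (hin : s.field 0 = inp) (h1 : s.field 1 = 0) (h2 : s.field 2 = 0)
    (hN : N = n ^ (d / 2)) (hδ : ∀ q < N, genCount inp n m D d q ≤ δ) :
    let t := mainProg.run s
    (∀ i < offset n d, t.field 1 i = 0) ∧ t.field 1 (offset n d + (N - 1)) = 1 ∧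
      ∀ q < N - 1, ∃ V : Submodule K (ℕ → K), (∀ q' ≤ q, genSet inp n m D d q' ⊆ V) ∧
        (∀ q' < q, outCol N (offset n d) t q' ∈ V) ∧
        (q * (δ + 1) + δ < N → outCol N (offset n d) t q ∉ V) := by
  intro t
  have hN0 : 0 < N := by
    rw [hN]
    exact Nat.pow_pos hn
  have hrow0 : rowsOf N s = 0 := by
    funext p c
    simp [rowsOf, h2]
  have hpiv0 : pivots N (rowsOf N s) = ∅ := by
    ext p
    simp [mem_pivots, hrow0]
  have key := iterate_induction (x := 4) (body := columnProg.run) (s := s)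
    (motive := fun r u => SameNat 4 s u ∧ u.field 0 = inp ∧ Echelon N (rowsOf N u) ∧
      (∀ i < offset n d, u.field 1 i = 0) ∧
      (pivots N (rowsOf N u)).card ≤ r * (δ + 1) ∧
      (∀ q < r, genSet inp n m D d q ⊆ rowSpan N (rowsOf N u)) ∧
      (∀ q < r, outCol N (offset n d) u q ∈ rowSpan N (rowsOf N u)) ∧
      ∀ q < r, ∃ V : Submodule K (ℕ → K), (∀ q' ≤ q, genSet inp n m D d q' ⊆ V) ∧
        (∀ q' < q, outCol N (offset n d) u q' ∈ V) ∧
        (q * (δ + 1) + δ < N → outCol N (offset n d) u q ∉ V)) N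
    ⟨SameNat.refl 4 s, hin, fun p hp => by simp [hpiv0] at hp, fun i _ => by simp [h1],
      by simp [hpiv0], fun q hq => absurd hq (Nat.not_lt_zero q),
      fun q hq => absurd hq (Nat.not_lt_zero q), fun q hq => absurd hq (Nat.not_lt_zero q)⟩ ?_
    N le_rfl
  · set u := iterate 4 columnProg.run s N with hu
    obtain ⟨k1, -, -, k4, -, -, -, k8⟩ := key
    have ru := hs.sameNat k1 le_rfl
    have ht : t = u.setField 1 (offset n d + (N - 1)) 1 := by
      have e1 : (Prog.loop 4 sizeE columnProg).run s = u := by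
        rw [hu, hN, ← hs.eval_sizeE]
        rfl
      have e2 : t = Prog.run (.setField 1 (outputE (.const 0) (.sub sizeE (.const 1))) .one) u := by
        rw [← e1]
        rfl
      rw [e2]
      simp only [Prog.run, outputE, entryE, NExpr.eval, FExpr.eval, ru.eval_sizeE, ← hN,
        ru.var_three, zero_mul, zero_add]
      rw [ru.off d (by omega)]
    -- The final assignment, which makes the output nonzero in any case, only affects column `N -
    -- 1`.
    have hcol : ∀ q < N - 1, outCol N (offset n d) t q = outCol N (offset n d) u q := by
      intro q hq
      funext p
      rw [outCol, outCol]
      split_ifs with hp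
      · have : offset n d + (p * N + q) ≠ offset n d + (N - 1) := fun e => by
          have e' : p * N + q = 0 * N + (N - 1) := by omega
          have := (entry_inj (by omega) (by omega) e').2
          omega
        rw [ht]
        simp only [State.setField, Function.update_self]
        exact Function.update_of_ne this _ _
      · rfl
    refine ⟨fun i hi => ?_, ?_, fun q hq => ?_⟩
    · have : i ≠ offset n d + (N - 1) := by omega
      rw [ht]
      simp only [State.setField, Function.update_self]
      rw [Function.update_of_ne this]
      exact k4 i hi
    · simp [ht, State.setField]
    · obtain ⟨V, hV1, hV2, hV3⟩ := k8 q (by omega)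
      refine ⟨V, hV1, fun q' hq' => ?_, ?_⟩
      · rw [hcol q' (by omega)]
        exact hV2 q' hq'
      · rw [hcol q hq]
        exact hV3
  · rintro r hr u ⟨k1, k2, k3, k4, k5, k6, k7, k8⟩
    have hu := sameNat_setVar 4 r u
    have ru := hs.sameNat (k1.trans hu) le_rfl
    obtain ⟨c1, c2, c3, c4, c5, c6, V, hV1, hV2, hV3, hV4⟩ :=
      columnProg_run (q := r) (N := N) hd ru k2 (by simp [State.setVar]) (hN ▸ k3) hN
    set w := columnProg.run (u.setVar 4 r) with hw
    have hδr := hδ r hr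
    -- Each column adds at most `δ` pivots for its vectors `genVec` and one for itself.
    have k5' : (pivots N (rowsOf N (u.setVar 4 r))).card ≤ r * (δ + 1) := k5
    have hcol : ∀ q < r, outCol N (offset n d) w q = outCol N (offset n d) u q := by
      intro q hq
      funext p
      rw [outCol, outCol]
      split_ifs with hp
      · exact c4 _ fun p' _ e => by
          have e' : p' * N + r = p * N + q := by omega
          have := (entry_inj hr (by omega) e').2
          omega
      · rfl
    refine ⟨(k1.trans hu).trans (c1.mono (by omega)), c2, c3, fun i hi => ?_, ?_, fun q hq => ?_,
      fun q hq => ?_, fun q hq => ?_⟩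
    · exact (c4 i fun p _ => by omega).trans (k4 i hi)
    · rw [Nat.add_mul, one_mul]
      omega
    · rcases Nat.lt_succ_iff_lt_or_eq.1 hq with hq | rfl
      · exact (k6 q hq).trans (hV1.trans hV2)
      · exact hV3.trans hV2
    · rcases Nat.lt_succ_iff_lt_or_eq.1 hq with hq | rfl
      · rw [hcol q hq]
        exact (hV1.trans hV2) (k7 q hq)
      · exact c6
    · rcases Nat.lt_succ_iff_lt_or_eq.1 hq with hq | rfl
      · obtain ⟨V', a1, a2, a3⟩ := k8 q hq
        refine ⟨V', a1, fun q' hq' => ?_, ?_⟩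
        · rw [hcol q' (hq'.trans hq)]
          exact a2 q' hq'
        · rw [hcol q hq]
          exact a3
      · refine ⟨V, fun q' hq' => ?_, fun q' hq' => ?_, fun hlt => hV4 (by omega)⟩
        · rcases hq'.lt_or_eq with hq' | rfl
          · exact (k6 q' hq').trans hV1
          · exact hV3
        · rw [hcol q' hq']
          exact hV1 (k7 q' hq')

end Main

/-! ### The tables of powers and offsets -/

/-- The entry after the current one. -/
def nextE : NExpr := .add (.var 4) (.const 1)

/-- Writes the next power of the number of variables. -/
def powProg : Prog := .setNat 0 nextE (.mul (.get 0 (.var 4)) (.var 0))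

/-- Writes the next offset. -/
def offsetProg : Prog := .setNat 1 nextE (.add (.get 1 (.var 4)) (.get 0 (.var 4)))

/-- Computes the tables of powers and offsets. -/
def tableProg : Prog :=
  .seq (.setNat 0 (.const 0) (.const 1))
    (.loop 4 (.add (.var 2) (.var 3)) (.seq powProg offsetProg))

section Tables

variable {K : Type*}

/-- A table with `r + 1` entries. -/
def table (f : ℕ → ℕ) (r : ℕ) : ℕ → ℕ := fun i => if i ≤ r then f i else 0

theorem update_table (f : ℕ → ℕ) (r : ℕ) :
    Function.update (table f r) (r + 1) (f (r + 1)) = table f (r + 1) := by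
  funext i
  by_cases h : i = r + 1
  · subst h
    simp [table]
  · have : i ≤ r ↔ i ≤ r + 1 := by omega
    simp [table, h, this]

/-- The arrays while the tables are computed. -/
def tables (n r r' : ℕ) : ℕ → ℕ → ℕ := fun a =>
  if a = 0 then table (fun i => n ^ i) r else if a = 1 then table (offset n) r' else 0

theorem tables_le {n r r' L T : ℕ} (hr : r ≤ L) (hr' : r' ≤ L)
    (hT : ∀ i ≤ L, n ^ i ≤ T ∧ offset n i ≤ T) (a i : ℕ) : tables n r r' a i ≤ T := by
  rw [tables]
  split_ifs
  · rw [table]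
    split_ifs
    · exact (hT i (by omega)).1
    · exact Nat.zero_le _
  · rw [table]
    split_ifs
    · exact (hT i (by omega)).2
    · exact Nat.zero_le _
  · exact Nat.zero_le _

/-- The state before the tables are filled up. -/
def tableState (s : State K) : State K := s.setNat 0 0 1

theorem tableState_nat {s : State K} (n : ℕ) (hs : s.nat = 0) :
    (tableState s).nat = tables n 0 0 := by
  funext a i
  by_cases ha : a = 0
  · subst ha
    by_cases hi : i = 0 <;> simp [tableState, State.setNat, tables, table, hs, hi]
  · by_cases ha' : a = 1
    · subst ha'
      by_cases hi : i = 0 <;> simp [tableState, State.setNat, tables, table, hs, offset, hi]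
    · simp [tableState, State.setNat, tables, hs, ha, ha']

variable [Field K]

theorem powProg_run {n r r' : ℕ} {t : State K} (h0 : t.var 0 = n) (h4 : t.var 4 = r)
    (ht : t.nat = tables n r r') :
    (powProg.run t).nat = tables n (r + 1) r' ∧ (powProg.run t).var = t.var ∧
      (powProg.run t).field = t.field := by
  refine ⟨?_, rfl, rfl⟩
  simp only [powProg, nextE, Prog.run, NExpr.eval, State.setNat, h0, h4, ht]
  have h1 : tables n r r' 0 r * n = n ^ (r + 1) := by simp [tables, table, pow_succ]
  rw [h1]
  funext a
  by_cases ha : a = 0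
  · subst ha
    rw [Function.update_self]
    exact update_table (fun i => n ^ i) r
  · rw [Function.update_of_ne ha]
    simp [tables, ha]

theorem offsetProg_run {n r : ℕ} {t : State K} (h4 : t.var 4 = r)
    (ht : t.nat = tables n (r + 1) r) :
    (offsetProg.run t).nat = tables n (r + 1) (r + 1) ∧ (offsetProg.run t).var = t.var ∧
      (offsetProg.run t).field = t.field := by
  refine ⟨?_, rfl, rfl⟩
  simp only [offsetProg, nextE, Prog.run, NExpr.eval, State.setNat, h4, ht]
  have h1 : tables n (r + 1) r 1 r + tables n (r + 1) r 0 r = offset n (r + 1) := by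
    simp [tables, table, offset_succ]
  rw [h1]
  funext a
  by_cases ha : a = 1
  · subst ha
    rw [Function.update_self]
    exact update_table (offset n) r
  · rw [Function.update_of_ne ha]
    simp [tables, ha]

theorem tableProg_iterate {n : ℕ} {s : State K} (hs : s.nat = 0) (h0 : s.var 0 = n) (r : ℕ) :
    let t := iterate 4 (Prog.seq powProg offsetProg).run (tableState s) r
    t.nat = tables n r r ∧ (∀ x < 4, t.var x = s.var x) ∧ t.field = s.field := by
  refine iterate_induction (x := 4) (body := (Prog.seq powProg offsetProg).run) (s := tableState s)
    (motive := fun r t => t.nat = tables n r r ∧ (∀ x < 4, t.var x = s.var x) ∧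
      t.field = s.field) r ⟨tableState_nat n hs, fun _ _ => rfl, rfl⟩ ?_ r le_rfl
  rintro k - t ⟨t1, t2, t3⟩
  have h1 := (sameNat_setVar 4 k t).var_eq
  obtain ⟨p1, p2, p3⟩ := powProg_run (t := t.setVar 4 k) (n := n) (r := k) (r' := k)
    ((h1 0 (by omega)).trans ((t2 0 (by omega)).trans h0)) (by simp [State.setVar]) t1
  obtain ⟨o1, o2, o3⟩ := offsetProg_run (n := n) (t := powProg.run (t.setVar 4 k)) (r := k)
    (by rw [p2]; simp [State.setVar]) p1
  refine ⟨o1, fun x hx => ?_, ?_⟩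
  · rw [Prog.run, o2, p2, h1 x hx, t2 x hx]
  · rw [Prog.run, o3, p3]
    exact t3

theorem tableProg_run {n m D d : ℕ} {s : State K} (hs : s.nat = 0) (h0 : s.var 0 = n)
    (h1 : s.var 1 = m) (h2 : s.var 2 = D) (h3 : s.var 3 = d) :
    let t := tableProg.run s
    t.nat = tables n (D + d) (D + d) ∧ (∀ x < 4, t.var x = s.var x) ∧ t.field = s.field ∧
      Ready n m D d t := by
  intro t
  have ht : t = iterate 4 (Prog.seq powProg offsetProg).run (tableState s) (D + d) := by
    rw [← h2, ← h3]
    rfl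
  obtain ⟨t1, t2, t3⟩ := tableProg_iterate hs h0 (D + d)
  rw [← ht] at t1 t2 t3
  exact ⟨t1, t2, t3, (t2 1 (by omega)).trans h1, (t2 2 (by omega)).trans h2,
    (t2 3 (by omega)).trans h3, fun i hi => by simp [t1, tables, table, hi],
    fun i hi => by simp [t1, tables, table, hi]⟩

/-- This program does compute natural numbers, so the structural bound for scoped programs does not
apply to its loop. Instead the exact contents of the tables are known in each round, and they stay
below `T`. -/
theorem tableProg_time (K : Type*) [Field K] : ∃ c, ∀ (n D d T : ℕ) (s : State K), 2 ≤ T →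
    s.nat = 0 → s.var 0 = n → s.var 2 = D → s.var 3 = d → (∀ x < 4, s.var x ≤ T) →
    (∀ i ≤ D + d, n ^ i ≤ T ∧ offset n i ≤ T) → tableProg.time s ≤ T ^ c := by
  have hnext : nextE.Scoped 5 := ⟨by simp [NExpr.Scoped], trivial⟩
  have hpow : PolyBounded 5 fun t : State K => powProg.time t :=
    ((polyBounded_const 5 1).add hnext.polyBounded_cost).add (NExpr.Scoped.polyBounded_cost
      (e := .mul (.get 0 (.var 4)) (.var 0)) (by simp [NExpr.Scoped]))
  have hoff : PolyBounded 5 fun t : State K => offsetProg.time t :=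
    ((polyBounded_const 5 1).add hnext.polyBounded_cost).add (NExpr.Scoped.polyBounded_cost
      (e := .add (.get 1 (.var 4)) (.get 0 (.var 4))) (by simp [NExpr.Scoped]))
  obtain ⟨c₁, hc₁⟩ := hpow
  obtain ⟨c₂, hc₂⟩ := hoff
  obtain ⟨c, hc⟩ := loop_time_le (K := K) (v := 4) (e := .add (.var 2) (.var 3))
    (by simp [NExpr.Scoped]) (c₁ + c₂ + 1)
  refine ⟨c + 3, fun n D d T s hT hs h0 h2 h3 hvar hpo => ?_⟩
  have hT0 : 0 < T := by omega
  have hb0 : Bounded 4 T (tableState s) := ⟨hvar, fun a i => by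
    rw [tableState_nat n hs]
    exact tables_le (Nat.zero_le _) (Nat.zero_le _) hpo a i⟩
  have hloop := hc (.seq powProg offsetProg) T (tableState s) hT hb0 ?_
  · have h4 : tableProg.time s = 4 + (Prog.loop 4 (.add (.var 2) (.var 3))
        (.seq powProg offsetProg)).time (tableState s) := rfl
    have h5 : 1 ≤ T ^ c := Nat.one_le_pow _ _ hT0
    have h6 : T ^ c * 2 ^ 3 ≤ T ^ c * T ^ 3 := Nat.mul_le_mul_left _ (Nat.pow_le_pow_left hT 3)
    rw [h4, pow_add]
    omega
  · intro k hk T' hTT' hkT'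
    have hkD : k < D + d := by
      rw [← h2, ← h3]
      exact hk
    obtain ⟨t1, t2, -⟩ := tableProg_iterate hs h0 k
    set t := (iterate 4 (Prog.seq powProg offsetProg).run (tableState s) k).setVar 4 k with ht
    have hvar' : ∀ x < 5, t.var x ≤ T' := fun x hx => by
      rcases Nat.lt_succ_iff_lt_or_eq.1 hx with hx | rfl
      · rw [ht, (sameNat_setVar 4 k _).var_eq x hx, t2 x hx]
        exact (hvar x hx).trans hTT'
      · simpa [ht, State.setVar] using hkT'
    have hle : ∀ r r', r ≤ D + d → r' ≤ D + d → ∀ a i, tables n r r' a i ≤ T' :=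
      fun r r' hr hr' a i => (tables_le hr hr' hpo a i).trans hTT'
    obtain ⟨p1, p2, -⟩ := powProg_run (t := t) (n := n) (r := k) (r' := k)
      (by rw [ht, (sameNat_setVar 4 k _).var_eq 0 (by omega), t2 0 (by omega), h0])
      (by simp [ht, State.setVar]) t1
    have hnat : t.nat = tables n k k := t1
    have e1 := hc₁ T' t (hT.trans hTT') ⟨hvar', fun a i => by
      rw [hnat]
      exact hle k k hkD.le hkD.le a i⟩
    have e2 := hc₂ T' (powProg.run t) (hT.trans hTT') ⟨fun x hx => by
      rw [p2]
      exact hvar' x hx, fun a i => by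
      rw [p1]
      exact hle (k + 1) k hkD hkD.le a i⟩
    have e3 : T' ^ c₁ ≤ T' ^ (c₁ + c₂) := Nat.pow_le_pow_right (by omega) (by omega)
    have e4 : T' ^ c₂ ≤ T' ^ (c₁ + c₂) := Nat.pow_le_pow_right (by omega) (by omega)
    have e5 : T' ^ (c₁ + c₂) * 2 ≤ T' ^ (c₁ + c₂) * T' :=
      Nat.mul_le_mul_left _ (hT.trans hTT')
    rw [pow_succ, Prog.time]
    simp only at e1 e2
    omega

end Tables

/-! ### The running time of the whole program -/

section TotalTime

variable {K : Type*} [Field K] {n m : ℕ}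

theorem pow_le_numMonomials (n D : ℕ) : n ^ D ≤ numMonomials n D :=
  Finset.single_le_sum (f := fun i => n ^ i) (fun _ _ => Nat.zero_le _) (by simp)

theorem lt_numMonomials {n : ℕ} (hn : 1 ≤ n) (D : ℕ) : D + 1 ≤ numMonomials n D := by
  have := Finset.card_nsmul_le_sum (Finset.range (D + 1)) (fun i => n ^ i) 1
    fun i _ => Nat.one_le_pow _ _ hn
  simpa [numMonomials] using this

/-- All natural numbers in play are at most `S ^ 4`, where `S` is the number of coefficients: powers
up to the exponent `D + d` are at most `n ^ D * n ^ d ≤ S ^ 2`, and offsets sum at most `S ^ 2` of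
them. -/
theorem whole_time (K : Type*) [Field K] : ∃ C, ∀ (n m d : ℕ) (h : Fin m → NCPoly K n), 1 ≤ n →
    1 ≤ m → 2 ≤ d →
    (Prog.seq tableProg mainProg).time (inputState h d) ≤ C * numCoeffs h d ^ C := by
  obtain ⟨c₁, hc₁⟩ := tableProg_time K
  obtain ⟨c₂, hc₂⟩ := scoped_mainProg.polyBounded_time (K := K)
  refine ⟨4 * (c₁ + c₂ + 1), fun n m d h hn hm hd => ?_⟩
  set D := helpDegree h with hD
  set S := numCoeffs h d with hS
  have hSdef : S = m * numMonomials n D + numMonomials n d := rfl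
  have hDS : numMonomials n D ≤ S := by
    rw [hSdef]
    exact (Nat.le_mul_of_pos_left _ hm).trans (Nat.le_add_right _ _)
  have hdS : numMonomials n d ≤ S := by
    rw [hSdef]
    exact Nat.le_add_left _ _
  have hmS : m ≤ S := by
    rw [hSdef]
    exact (Nat.le_mul_of_pos_right _ (by have := lt_numMonomials hn D; omega)).trans
      (Nat.le_add_right _ _)
  have hD1 := (lt_numMonomials hn D).trans hDS
  have hd1 := (lt_numMonomials hn d).trans hdS
  have hS2 : 2 ≤ S := by omega
  have hnS : n ≤ S := ((Nat.le_self_pow (by omega) n).trans (pow_le_numMonomials n d)).trans hdS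
  have hpow : ∀ i ≤ D + d, n ^ i ≤ S ^ 2 := fun i hi => by
    refine (Nat.pow_le_pow_right hn hi).trans ?_
    rw [pow_add, pow_two]
    exact Nat.mul_le_mul ((pow_le_numMonomials n D).trans hDS)
      ((pow_le_numMonomials n d).trans hdS)
  have hS4 : ∀ x, x ≤ S ^ 2 → x ≤ S ^ 4 := fun x hx =>
    hx.trans (Nat.pow_le_pow_right (by omega) (by omega))
  have hSS : S ≤ S ^ 4 := Nat.le_self_pow (by omega) S
  have hoff : ∀ i ≤ D + d, offset n i ≤ S ^ 4 := fun i hi => by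
    have h1 := Finset.sum_le_card_nsmul (Finset.range i) (fun i => n ^ i) (S ^ 2) fun j hj =>
      hpow j ((Finset.mem_range.1 hj).le.trans hi)
    rw [Finset.card_range, smul_eq_mul] at h1
    have h2 : i ≤ S ^ 2 := by nlinarith
    calc offset n i ≤ i * S ^ 2 := h1
      _ ≤ S ^ 2 * S ^ 2 := Nat.mul_le_mul_right _ h2
      _ = S ^ 4 := by ring
  have hT2 : 2 ≤ S ^ 4 := hS2.trans hSS
  have hpo : ∀ i ≤ D + d, n ^ i ≤ S ^ 4 ∧ offset n i ≤ S ^ 4 := fun i hi =>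
    ⟨hS4 _ (hpow i hi), hoff i hi⟩
  set s := inputState h d with hs
  have hvar : ∀ x < 4, s.var x ≤ S ^ 4 := fun x hx => by
    refine le_trans ?_ hSS
    interval_cases x
    · exact hnS
    · exact hmS
    · change D ≤ S
      omega
    · change d ≤ S
      omega
  have hnat : s.nat = 0 := rfl
  have e1 := hc₁ n D d (S ^ 4) s hT2 hnat rfl rfl rfl hvar hpo
  obtain ⟨t1, t2, -, -⟩ := tableProg_run (n := n) (m := m) (D := D) (d := d) hnat rfl rfl rfl rfl
  have e2 : mainProg.time (tableProg.run s) ≤ (S ^ 4) ^ c₂ :=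
    hc₂ (S ^ 4) (tableProg.run s) hT2 ⟨fun x hx => by
      rw [t2 x hx]
      exact hvar x hx, fun a i => by
      rw [t1]
      exact tables_le le_rfl le_rfl hpo a i⟩
  have e3 : (S ^ 4) ^ c₁ ≤ (S ^ 4) ^ (c₁ + c₂) := Nat.pow_le_pow_right (by omega) (by omega)
  have e4 : (S ^ 4) ^ c₂ ≤ (S ^ 4) ^ (c₁ + c₂) := Nat.pow_le_pow_right (by omega) (by omega)
  have e5 : (S ^ 4) ^ (c₁ + c₂) * 2 ≤ (S ^ 4) ^ (c₁ + c₂) * S ^ 4 := Nat.mul_le_mul_left _ hT2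
  have e6 : (Prog.seq tableProg mainProg).time s ≤ S ^ (4 * (c₁ + c₂ + 1)) := by
    rw [pow_mul, pow_succ, Prog.time]
    omega
  exact e6.trans (Nat.le_mul_of_pos_left _ (by omega))

end TotalTime

/-! ### Vectors from right quotients of the help polynomials -/

section Vectors

variable {K : Type*} [Field K] {n m : ℕ}

theorem coeff_single_mul_mul (a : FreeMonoid (Fin n)) (r : K) (f : NCPoly K n)
    {a' b : FreeMonoid (Fin n)} (hl : a'.length = a.length) :
    (MonoidAlgebra.single a r * f : NCPoly K n).coeff (a' * b) =
      if a' = a then r * f.coeff b else 0 := by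
  split_ifs with h
  · subst h
    exact MonoidAlgebra.coeff_single_mul_eq_mul_coeff b fun _ _ => mul_right_inj _
  · exact MonoidAlgebra.coeff_single_mul_of_forall_mul_ne r f fun e he =>
      h (mul_eq_mul_of_length he hl.symm).1.symm

/-- The coefficients of a polynomial at the words of length `s`. -/
def wordCoeffs (s : ℕ) : NCPoly K n →ₗ[K] (ℕ → K) where
  toFun f p := if p < n ^ s then f.coeff (word n s p) else 0
  map_add' f g := by
    funext p
    by_cases hp : p < n ^ s <;> simp [hp]
  map_smul' c f := by
    funext p
    by_cases hp : p < n ^ s <;> simp [hp]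

theorem wordCoeffs_apply (s : ℕ) (f : NCPoly K n) (p : ℕ) :
    wordCoeffs s f p = if p < n ^ s then f.coeff (word n s p) else 0 := rfl

theorem coeff_eq_zero_of_helpDegree_lt {h : Fin m → NCPoly K n} {j : Fin m}
    {w : FreeMonoid (Fin n)} (hw : helpDegree h < w.length) : (h j).coeff w = 0 := by
  by_contra hne
  have h1 : w.length ≤ degree (h j) :=
    Finset.le_sup (f := FreeMonoid.length) (Finsupp.mem_support_iff.2 hne)
  have h2 : degree (h j) ≤ helpDegree h :=
    Finset.le_sup (f := fun j => degree (h j)) (Finset.mem_univ j)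
  omega

theorem position_lt {w : FreeMonoid (Fin n)} {D : ℕ} (hw : w.length ≤ D) :
    position w < numMonomials n D := by
  have h1 := wordIndex_lt w
  have h2 := offset_mono n (Nat.succ_le_succ hw)
  rw [Nat.succ_eq_add_one, offset_succ] at h2
  rw [position_eq]
  exact lt_of_lt_of_le (Nat.add_lt_add_left h1 _) h2

theorem inputState_field {h : Fin m → NCPoly K n} (d : ℕ) (j : Fin m) {i : ℕ}
    (hi : i < numMonomials n (helpDegree h)) :
    (inputState h d).field 0 (j * numMonomials n (helpDegree h) + i) = coeffAt (h j) i := by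
  set M := numMonomials n (helpDegree h) with hM
  have h1 : ((j : ℕ) * M + i) / M = j := by
    rw [mul_comm, Nat.mul_add_div (by omega), Nat.div_eq_of_lt hi, add_zero]
  have h2 : ((j : ℕ) * M + i) % M = i := by
    rw [mul_comm, Nat.mul_add_mod, Nat.mod_eq_of_lt hi]
  simp [inputState, ← hM, h1, h2]

/-- The coefficient at `a' * b` with `a'.length = a.length` is `r * (h j).coeff (b * a₀)` if `a' =
a`, and zero otherwise. For `a` shorter than `d / 2` this is a multiple of `genVec` with `k =
a.length` and `l = a₀.length - 1`, or zero if `b * a₀` is longer than every monomial of the input.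
-/
theorem wordCoeffs_single_mul {h : Fin m → NCPoly K n} {d : ℕ} {a a₀ b₀ : FreeMonoid (Fin n)}
    (r : K) {q : ℕ} {j : Fin m} (hq : word n (d / 2) q = a₀ * b₀) (hqN : q < n ^ (d / 2))
    (ha₀ : a₀ ≠ 1) {V : Submodule K (ℕ → K)}
    (hV : genSet ((inputState h d).field 0) n m (helpDegree h) d q ⊆ V) :
    wordCoeffs (d / 2) (MonoidAlgebra.single a r * dropConst (rightQuot a₀ (h j))) ∈ V := by
  set D := helpDegree h with hD
  have hlen : a₀.length + b₀.length = d / 2 := by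
    rw [← FreeMonoid.length_mul, ← hq, length_word hqN]
  have hpos : a₀.length ≠ 0 := fun e => ha₀ (FreeMonoid.length_eq_zero.1 e)
  rcases lt_or_ge a.length (d / 2) with hk | hk
  · have hval : ∀ p < n ^ (d / 2), ∃ b : FreeMonoid (Fin n), b.length = d / 2 - a.length ∧
        wordIndex b = p % n ^ (d / 2 - a.length) ∧
        (MonoidAlgebra.single a r * dropConst (rightQuot a₀ (h j)) : NCPoly K n).coeff
          (word n (d / 2) p) =
          if p / n ^ (d / 2 - a.length) = wordIndex a then r * (h j).coeff (b * a₀) else 0 := by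
      intro p hp
      obtain ⟨a', b, hw, ha'⟩ := exists_eq_mul (word n (d / 2) p) (k := a.length)
        (by rw [length_word hp]; exact hk.le)
      have hb : b.length = d / 2 - a.length := by
        have := congrArg FreeMonoid.length hw
        rw [length_word hp, FreeMonoid.length_mul] at this
        omega
      have hp' : wordIndex (a' * b) = p := by rw [← hw, wordIndex_word hp]
      refine ⟨b, hb, by rw [← hb, ← hp', wordIndex_mul_mod], ?_⟩
      have hb1 : b ≠ 1 := fun e => by
        rw [e, FreeMonoid.length_one] at hb
        omega
      have hdiv : p / n ^ (d / 2 - a.length) = wordIndex a' := by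
        rw [← hb, ← hp', wordIndex_mul_div]
      have hiff : a' = a ↔ wordIndex a' = wordIndex a :=
        ⟨fun e => by rw [e], wordIndex_injective ha'⟩
      rw [hw, coeff_single_mul_mul a r _ ha', hdiv, coeff_dropConst, if_neg hb1, coeff_rightQuot]
      simp only [hiff]
    by_cases hDlt : d / 2 - a.length + (a₀.length - 1 + 1) < D + 1
    · have hmem : genVec ((inputState h d).field 0) n D d q a.length (a₀.length - 1) j
          (wordIndex a) ∈ genSet ((inputState h d).field 0) n m D d q := by
        refine Set.mem_iUnion₂.2 ⟨a.length, hk, Set.mem_iUnion₂.2 ⟨a₀.length - 1, ?_,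
          Set.mem_iUnion₂.2 ⟨j, j.2, Set.mem_iUnion₂.2 ⟨wordIndex a, wordIndex_lt a, ?_⟩⟩⟩⟩
        · exact show a₀.length - 1 < d / 2 by omega
        · rw [if_pos hDlt]
          rfl
      have heq : wordCoeffs (d / 2) (MonoidAlgebra.single a r * dropConst (rightQuot a₀ (h j))) =
          r • genVec ((inputState h d).field 0) n D d q a.length (a₀.length - 1) j
            (wordIndex a) := by
        funext p
        rw [wordCoeffs_apply, Pi.smul_apply, genVec]
        by_cases hp : p < n ^ (d / 2)
        · obtain ⟨b, hb, hbi, hc⟩ := hval p hp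
          rw [if_pos hp, if_pos hp, hc]
          by_cases hpa : p / n ^ (d / 2 - a.length) = wordIndex a
          · rw [if_pos hpa, if_pos hpa, smul_eq_mul]
            congr 1
            have e1 : a₀.length - 1 + 1 = a₀.length := by omega
            have e2 : d / 2 - a₀.length = b₀.length := by omega
            have e3 : q / n ^ b₀.length = wordIndex a₀ := by
              rw [← wordIndex_mul_div a₀ b₀, ← hq, wordIndex_word hqN]
            have e4 : (b * a₀).length = d / 2 - a.length + a₀.length := by
              rw [FreeMonoid.length_mul, hb]
            have e5 : (b * a₀).length ≤ D := by omega
            have e6 := position_eq (b * a₀)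
            rw [e4, wordIndex_mul] at e6
            rw [e1, e2, e3, ← hbi, ← coeffAt_position, ← inputState_field d j (position_lt e5), e6]
            congr 1
            rw [add_assoc, add_assoc]
            rfl
          · rw [if_neg hpa, if_neg hpa, smul_zero]
        · rw [if_neg hp, if_neg hp, smul_zero]
      rw [heq]
      exact Submodule.smul_mem _ _ (hV hmem)
    · have heq : wordCoeffs (d / 2) (MonoidAlgebra.single a r * dropConst (rightQuot a₀ (h j))) =
          0 := by
        funext p
        rw [wordCoeffs_apply]
        split_ifs with hp
        · obtain ⟨b, hb, -, hc⟩ := hval p hp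
          rw [hc, coeff_eq_zero_of_helpDegree_lt (by rw [FreeMonoid.length_mul, hb]; omega),
            mul_zero, ite_self]
          rfl
        · rfl
      rw [heq]
      exact zero_mem _
  -- If `a` has length at least `d / 2`, only the constant term of the second factor could
  -- contribute, and it has been dropped.
  · have heq : wordCoeffs (d / 2) (MonoidAlgebra.single a r * dropConst (rightQuot a₀ (h j))) =
        0 := by
      funext p
      rw [wordCoeffs_apply]
      split_ifs with hp
      · by_cases he : ∃ e, a * e = word n (d / 2) p
        · obtain ⟨e, he⟩ := he
          have h1 := congrArg FreeMonoid.length he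
          rw [length_word hp, FreeMonoid.length_mul] at h1
          have h2 : e = 1 := FreeMonoid.length_eq_zero.1 (by omega)
          rw [← he, coeff_single_mul_mul a r _ rfl, if_pos rfl, coeff_dropConst, if_pos h2,
            mul_zero]
          rfl
        · push Not at he
          exact MonoidAlgebra.coeff_single_mul_of_forall_mul_ne r _ he
      · rfl
    rw [heq]
    exact zero_mem _

theorem wordCoeffs_mem_of_mem_quotIdeal {h : Fin m → NCPoly K n} {d : ℕ} {Q : Set ℕ}
    (hQ : ∀ q ∈ Q, q < n ^ (d / 2)) {V : Submodule K (ℕ → K)}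
    (hV : ∀ q ∈ Q, genSet ((inputState h d).field 0) n m (helpDegree h) d q ⊆ V) {x : NCPoly K n}
    (hx : x ∈ quotIdeal h (word n (d / 2) '' Q)) : wordCoeffs (d / 2) x ∈ V := by
  -- `wordCoeffs` is linear over `K` only, so the induction over the left ideal carries an arbitrary
  -- left factor.
  suffices H : ∀ y : NCPoly K n, wordCoeffs (d / 2) (y * x) ∈ V by simpa using H 1
  induction hx using Submodule.span_induction with
  | mem x hx =>
    obtain ⟨_, ⟨q, hq, rfl⟩, a, b, ha, hab, j, rfl⟩ := hx
    intro y
    induction y using MonoidAlgebra.induction_linear with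
    | zero => simp
    | add y₁ y₂ h₁ h₂ =>
      rw [add_mul, map_add]
      exact add_mem h₁ h₂
    | single c r => exact wordCoeffs_single_mul r hab (hQ q hq) ha (hV q hq)
  | zero => simp
  | add x₁ x₂ _ _ h₁ h₂ =>
    intro y
    rw [mul_add, map_add]
    exact add_mem (h₁ y) (h₂ y)
  | smul z x _ ih =>
    intro y
    rw [smul_eq_mul, ← mul_assoc]
    exact ih _

end Vectors

/-! ### The number of nonzero vectors -/

section Count

variable {K : Type*} [Field K] {n m : ℕ}

theorem length_ge_of_coeff_ne_zero {h : Fin m → NCPoly K n} {B : ℝ}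
    (hh : ∀ g ∈ highParts h, B ≤ (degree g : ℝ)) {j : Fin m} {w : FreeMonoid (Fin n)}
    (hw : (h j).coeff w ≠ 0) (h2 : 2 ≤ w.length) : B ≤ (w.length : ℝ) := by
  set g := homogeneousPart w.length (h j) with hg
  have hcoeff : g.coeff w = (h j).coeff w := by simp [hg, homogeneousPart]
  have h1 := hh g ⟨fun e => hw (by rw [← hcoeff, e]; rfl), j, w.length, h2, rfl⟩
  refine h1.trans (Nat.cast_le.2 (Finset.sup_le fun v hv => ?_))
  rw [hg, homogeneousPart, Finsupp.support_filter, Finset.mem_filter] at hv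
  exact hv.2.le

/-- The entries are coefficients of `h j` at words of length `i = d / 2 - k + (l + 1)`. Here `2 ≤ i
≤ d - k < B`, so this length falls into the degree gap. -/
theorem genVec_eq_zero {h : Fin m → NCPoly K n} {d k l a q : ℕ} {B : ℝ}
    (hh : ∀ g ∈ highParts h, B ≤ (degree g : ℝ)) (hk : k < d / 2) (hl : l < d / 2)
    (hq : q < n ^ (d / 2)) (j : Fin m) (hD : d / 2 - k + (l + 1) < helpDegree h + 1)
    (hB : (d : ℝ) - k < B) :
    genVec ((inputState h d).field 0) n (helpDegree h) d q k l j a = 0 := by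
  set D := helpDegree h with hDdef
  funext p
  rw [genVec]
  split_ifs with hp hpa
  · set i := d / 2 - k + (l + 1) with hi
    set b := p % n ^ (d / 2 - k) * n ^ (l + 1) + q / n ^ (d / 2 - (l + 1)) with hb
    have hn : 0 < n := by
      rcases Nat.eq_zero_or_pos n with rfl | hn
      · rw [zero_pow (by omega)] at hq
        omega
      · exact hn
    have h1 : p % n ^ (d / 2 - k) < n ^ (d / 2 - k) := Nat.mod_lt _ (Nat.pow_pos hn)
    have h2 : q / n ^ (d / 2 - (l + 1)) < n ^ (l + 1) := by
      refine Nat.div_lt_of_lt_mul ?_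
      rw [← pow_add]
      convert hq using 2
      omega
    have hbi : b < n ^ i := by
      rw [hi, pow_add]
      calc b < p % n ^ (d / 2 - k) * n ^ (l + 1) + n ^ (l + 1) := Nat.add_lt_add_left h2 _
        _ = (p % n ^ (d / 2 - k) + 1) * n ^ (l + 1) := by ring
        _ ≤ n ^ (d / 2 - k) * n ^ (l + 1) := Nat.mul_le_mul_right _ h1
    have hlt : offset n i + b < numMonomials n D := by
      have h3 := offset_mono n (show i + 1 ≤ D + 1 by omega)
      rw [offset_succ] at h3
      exact lt_of_lt_of_le (Nat.add_lt_add_left hbi _) h3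
    have h4 := inputState_field d j hlt
    have h5 : (j : ℕ) * offset n (D + 1) + offset n i + p % n ^ (d / 2 - k) * n ^ (l + 1) +
        q / n ^ (d / 2 - (l + 1)) = j * numMonomials n D + (offset n i + b) := by
      rw [hb, ← add_assoc, ← add_assoc]
      rfl
    rw [h5, h4]
    by_contra hne
    obtain ⟨w, hw, hwc⟩ := exists_of_coeffAt_ne_zero hne
    have hwl := length_eq_of_position hbi hw
    have h6 := length_ge_of_coeff_ne_zero hh hwc (by omega)
    have h7 : i + k ≤ d := by omega
    have h8 : (i : ℝ) + k ≤ d := by exact_mod_cast h7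
    rw [hwl] at h6
    linarith
  · rfl
  · rfl

/-- Only `k ≤ e` contributes, and for such `k` there are `n ^ k ≤ n ^ e` choices of the leading
word; the other factors count the choices of `k`, `l` and `j`. -/
theorem genCount_le {h : Fin m → NCPoly K n} {d q : ℕ} {e : ℝ} (hn : 1 ≤ n)
    (hh : ∀ g ∈ highParts h, (d : ℝ) - e ≤ (degree g : ℝ)) (hq : q < n ^ (d / 2)) :
    (genCount ((inputState h d).field 0) n m (helpDegree h) d q : ℝ) ≤
      ((d / 2 : ℕ) : ℝ) * (((d / 2 : ℕ) : ℝ) * (m * (n : ℝ) ^ e)) := by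
  have hn' : (1 : ℝ) ≤ n := by exact_mod_cast hn
  rw [genCount, Nat.cast_sum]
  refine (Finset.sum_le_card_nsmul _ _ (((d / 2 : ℕ) : ℝ) * (m * (n : ℝ) ^ e)) fun k hk => ?_).trans
    (by rw [Finset.card_range, nsmul_eq_mul])
  rw [Nat.cast_sum]
  refine (Finset.sum_le_card_nsmul _ _ (m * (n : ℝ) ^ e) fun l hl => ?_).trans
    (by rw [Finset.card_range, nsmul_eq_mul])
  rw [Nat.cast_sum]
  refine (Finset.sum_le_card_nsmul _ _ ((n : ℝ) ^ e) fun j hj => ?_).trans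
    (by rw [Finset.card_range, nsmul_eq_mul])
  rw [Finset.mem_range] at hk hl hj
  by_cases hke : (k : ℝ) ≤ e
  · refine le_trans ?_ (Real.rpow_le_rpow_of_exponent_le hn' hke)
    rw [Real.rpow_natCast, ← Nat.cast_pow, Nat.cast_le]
    refine (Finset.sum_le_card_nsmul _ _ 1 fun a _ => ?_).trans (by simp)
    rw [nonzeroCount]
    split_ifs <;> omega
  · rw [Finset.sum_eq_zero, Nat.cast_zero]
    · positivity
    · intro a _
      split_ifs with hD
      · have := genVec_eq_zero (a := a) hh hk hl hq ⟨j, hj⟩ hD (by linarith)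
        rw [nonzeroCount, if_pos this]
      · rfl

end Count

/-! ### The lower bound -/

section LowerBound

variable {K : Type*} [Field K] {n m : ℕ}

/-- A system of homogeneous linear equations with more unknowns than equations has a solution. -/
theorem exists_relation {s r : ℕ} (hsr : s < r) (M : Fin s → ℕ → K) :
    ∃ c : ℕ → K, (∃ q < r, c q ≠ 0) ∧ ∀ v, ∑ q ∈ Finset.range r, c q * M v q = 0 := by
  let f : (Fin r → K) →ₗ[K] (Fin s → K) :=
    LinearMap.pi fun v => ∑ q : Fin r, M v q • LinearMap.proj q
  have hker : LinearMap.ker f ≠ ⊥ := LinearMap.ker_ne_bot_of_finrank_lt (by simpa using hsr)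
  obtain ⟨c, hc, hc0⟩ := (Submodule.ne_bot_iff _).1 hker
  obtain ⟨q, hq⟩ := Function.ne_iff.1 hc0
  refine ⟨fun i => if hi : i < r then c ⟨i, hi⟩ else 0, ⟨q, q.2, by simpa using hq⟩, fun v => ?_⟩
  rw [Finset.sum_range]
  have := congrFun (LinearMap.mem_ker.1 hc) v
  simpa [f, LinearMap.sum_apply, mul_comm] using this

/-- A program for a polynomial with `r` columns that are linearly independent modulo the vectors
`genVec` has size at least `r`. -/
theorem le_size {h : Fin m → NCPoly K n} {d r : ℕ} (hd : 2 ≤ d) (hr : r ≤ n ^ (d / 2))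
    {F : NCPoly K n} {col : ℕ → ℕ → K}
    (hcol : ∀ q < r, col q = wordCoeffs (d / 2) (rightQuot (word n (d / 2) q) F))
    (hind : ∀ q < r, ∃ V : Submodule K (ℕ → K),
      (∀ q' ≤ q, genSet ((inputState h d).field 0) n m (helpDegree h) d q' ⊆ V) ∧
      (∀ q' < q, col q' ∈ V) ∧ col q ∉ V)
    {A : ABP K n m} (hA : A.Computes h F) : r ≤ A.size := by
  by_contra hlt
  push Not at hlt
  obtain ⟨c, ⟨q₀, hq₀, hcq₀⟩, hc⟩ := exists_relation hlt fun v q =>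
    (A.polyBetween h v A.sink).coeff (word n (d / 2) q)
  -- Restricting to nonzero coefficients makes the maximum `Q` the leading term; the ideal then
  -- involves only words numbered up to `Q`, whose vectors lie in the space `V` for `Q`.
  set I := (Finset.range r).filter fun q => c q ≠ 0 with hI
  have hIne : I.Nonempty := ⟨q₀, by simp [hI, hq₀, hcq₀]⟩
  set Q := I.max' hIne with hQ
  have hQI : Q ∈ I := Finset.max'_mem I hIne
  have hIr : ∀ q ∈ I, q < r := fun q hq => Finset.mem_range.1 (Finset.mem_filter.1 hq).1
  obtain ⟨V, hV1, hV2, hV3⟩ := hind Q (hIr Q hQI)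
  have hmem := sum_smul_rightQuot_polyBetween_mem A h I c (word n (d / 2))
    (fun q hq e => by
      have := length_word (n := n) (s := d / 2) ((hIr q hq).trans_le hr)
      rw [e, FreeMonoid.length_one] at this
      omega) A.sink (fun v => by
      rw [← hc v, hI, Finset.sum_filter]
      refine Finset.sum_congr rfl fun q _ => ?_
      by_cases hq : c q = 0 <;> simp [hq]) A.source
  have hF : A.polyBetween h A.source A.sink = F := hA
  rw [hF] at hmem
  have hsum := wordCoeffs_mem_of_mem_quotIdeal (V := V)
    (fun q hq => (hIr q hq).trans_le hr) (fun q hq => hV1 q (Finset.le_max' I q hq)) hmem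
  rw [map_sum, ← Finset.add_sum_erase I _ hQI] at hsum
  have hrest : ∑ q ∈ I.erase Q, wordCoeffs (d / 2) (c q • rightQuot (word n (d / 2) q) F) ∈ V := by
    refine sum_mem fun q hq => ?_
    obtain ⟨hne, hqI⟩ := Finset.mem_erase.1 hq
    rw [map_smul, ← hcol q (hIr q hqI)]
    exact Submodule.smul_mem _ _ (hV2 q (lt_of_le_of_ne (Finset.le_max' I q hqI) hne))
  have hlead := (Submodule.add_mem_iff_left V hrest).1 hsum
  rw [map_smul, ← hcol Q (hIr Q hQI)] at hlead
  have hcQ : c Q ≠ 0 := (Finset.mem_filter.1 hQI).2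
  exact hV3 ((Submodule.smul_mem_iff V hcQ).1 hlead)

/-- The homogeneous polynomial of degree `d` with given coefficients. -/
def ofOutput (K : Type*) [Field K] (n d : ℕ) (g : ℕ → K) : NCPoly K n :=
  MonoidAlgebra.ofCoeff (Finsupp.ofSupportFinite
    (fun w => if w.length = d then g (position w) else 0)
    ((List.finite_length_eq (Fin n) d).subset fun w hw => by
      by_contra hl
      exact hw (if_neg hl)))

theorem coeff_ofOutput (d : ℕ) (g : ℕ → K) (w : FreeMonoid (Fin n)) :
    (ofOutput K n d g).coeff w = if w.length = d then g (position w) else 0 := rfl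

/-- The numerical estimates behind the bound. -/
theorem rpow_estimate {n m d : ℕ} {ε : ℝ} (hn : 1 ≤ n) (hm : 1 ≤ m) (hd : 2 ≤ d) (heven : Even d)
    (hε : 0 < ε) (hε1 : ε ≤ 1) {r δ : ℕ}
    (hr : (r : ℝ) ≤ (n : ℝ) ^ (ε * (d : ℝ) / 2) / (2 * (m : ℝ) * (d : ℝ) ^ 2))
    (hδ : (δ : ℝ) ≤ ((d / 2 : ℕ) : ℝ) * (((d / 2 : ℕ) : ℝ) *
      (m * (n : ℝ) ^ ((d : ℝ) / 2 - ε * d)))) :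
    r * (δ + 1) ≤ n ^ (d / 2) ∧ 8 * r ≤ n ^ (d / 2) := by
  have hn' : (1 : ℝ) ≤ n := by exact_mod_cast hn
  have hn0 : (0 : ℝ) < n := by linarith
  have hm' : (1 : ℝ) ≤ m := by exact_mod_cast hm
  have hd' : (2 : ℝ) ≤ d := by exact_mod_cast hd
  have hhalf : ((d / 2 : ℕ) : ℝ) = (d : ℝ) / 2 := by
    obtain ⟨e, rfl⟩ := heven
    have : (e + e) / 2 = e := by omega
    rw [this]
    push_cast
    ring
  set x := (n : ℝ) ^ (ε * (d : ℝ) / 2) with hx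
  set X := (n : ℝ) ^ ((d : ℝ) / 2 - ε * d) with hX
  have hN : ((n ^ (d / 2) : ℕ) : ℝ) = (n : ℝ) ^ ((d : ℝ) / 2) := by
    rw [← hhalf, Real.rpow_natCast, Nat.cast_pow]
  set N := (n : ℝ) ^ ((d : ℝ) / 2) with hNdef
  have hx0 : 0 < x := Real.rpow_pos_of_pos hn0 _
  have hX0 : 0 < X := Real.rpow_pos_of_pos hn0 _
  have hxN : x ≤ N := Real.rpow_le_rpow_of_exponent_le hn' (by nlinarith)
  have hxX : x * X ≤ N := by
    rw [hx, hX, ← Real.rpow_add hn0]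
    exact Real.rpow_le_rpow_of_exponent_le hn' (by nlinarith)
  have hden : 0 < 2 * (m : ℝ) * (d : ℝ) ^ 2 := by positivity
  rw [le_div_iff₀ hden] at hr
  have hr0 : (0 : ℝ) ≤ r := Nat.cast_nonneg r
  have hd2 : (4 : ℝ) ≤ (d : ℝ) ^ 2 := by nlinarith
  have hmd : (4 : ℝ) ≤ m * (d : ℝ) ^ 2 := by nlinarith
  have h8 : (8 : ℝ) * r ≤ x := by linarith [mul_le_mul_of_nonneg_left hmd hr0]
  -- Since `x * X = n ^ (d / 2 - ε * d / 2) ≤ N`, this and `8 * r ≤ x ≤ N` give `r * (δ + 1) ≤ N /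
  -- 4`.
  have h1 : (r : ℝ) * δ ≤ N / 8 := by
    rw [hhalf] at hδ
    calc (r : ℝ) * δ ≤ r * ((d : ℝ) / 2 * ((d : ℝ) / 2 * (m * X))) :=
          mul_le_mul_of_nonneg_left hδ hr0
      _ = (r * (2 * (m : ℝ) * (d : ℝ) ^ 2)) * X / 8 := by ring
      _ ≤ x * X / 8 := by gcongr
      _ ≤ N / 8 := by linarith
  constructor
  · have : ((r * (δ + 1) : ℕ) : ℝ) ≤ ((n ^ (d / 2) : ℕ) : ℝ) := by
      rw [hN]
      push_cast
      linarith
    exact_mod_cast this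
  · have : ((8 * r : ℕ) : ℝ) ≤ ((n ^ (d / 2) : ℕ) : ℝ) := by
      rw [hN]
      push_cast
      linarith
    exact_mod_cast this

end LowerBound

end NCABP

end

/-! ### The theorem: the program, its output polynomial and the size bound together. -/

theorem corollary5p5 (K : Type*) [Field K] (ε : ℝ) (hε : 0 < ε) (hε1 : ε ≤ 1) :
    ∃ (P : NCABP.Prog) (C : ℕ),
      ∀ (n m d : ℕ) (h : Fin m → NCABP.NCPoly K n), 1 ≤ n → 1 ≤ m → 2 ≤ d → Even d →
        (∀ g ∈ NCABP.highParts h, (1 / 2 + ε) * (d : ℝ) ≤ (NCABP.degree g : ℝ)) →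
        ∃ F : NCABP.NCPoly K n,
          F ≠ 0 ∧ NCABP.IsHomogeneousOfDegree F d ∧
          P.Writes h d F ∧
          P.time (NCABP.inputState h d) ≤ C * NCABP.numCoeffs h d ^ C ∧
          ∀ A : NCABP.ABP K n m, A.Computes h F →
            1 / ((d : ℝ) + 1) *
                (⌊(n : ℝ) ^ (ε * (d : ℝ) / 2) / (2 * (m : ℝ) * (d : ℝ) ^ 2)⌋ : ℝ) ≤ (A.size : ℝ) := by
  obtain ⟨C, hC⟩ := NCABP.whole_time K
  refine ⟨.seq NCABP.tableProg NCABP.mainProg, C, fun n m d h hn hm hd heven hh => ?_⟩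
  set P : NCABP.Prog := .seq NCABP.tableProg NCABP.mainProg with hP
  set N := n ^ (d / 2) with hN
  set inp := (NCABP.inputState h d).field 0 with hinp
  set δ := ⌊((d / 2 : ℕ) : ℝ) * (((d / 2 : ℕ) : ℝ) * (m * (n : ℝ) ^ ((d : ℝ) / 2 - ε * d)))⌋₊
    with hδ
  -- The degree gap is used with `e = d / 2 - ε * d`, for which `d - e = (1 / 2 + ε) * d`.
  have hcount : ∀ q < N, NCABP.genCount inp n m (NCABP.helpDegree h) d q ≤ δ := fun q hq =>
    Nat.le_floor (NCABP.genCount_le hn (fun g hg => by linarith [hh g hg]) hq)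
  obtain ⟨-, -, t3, t4⟩ := NCABP.tableProg_run (s := NCABP.inputState h d) (n := n) (m := m)
    (D := NCABP.helpDegree h) (d := d) rfl rfl rfl rfl rfl
  obtain ⟨r1, r2, r3⟩ := NCABP.mainProg_run (N := N) (inp := inp) hd hn t4 (by rw [t3])
    (by rw [t3]; rfl) (by rw [t3]; rfl) hN hcount
  have hrun : P.run (NCABP.inputState h d) =
    NCABP.mainProg.run (NCABP.tableProg.run (NCABP.inputState h d)) := rfl
  rw [← hrun] at r1 r2 r3
  set t := P.run (NCABP.inputState h d) with ht
  set F := NCABP.ofOutput K n d (t.field 1) with hF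
  have hN0 : 0 < N := Nat.pow_pos hn
  have hhalf : d / 2 + d / 2 = d := by
    obtain ⟨e, rfl⟩ := heven
    omega
  have hpos : ∀ p < N, ∀ q < N,
      F.coeff (NCABP.word n (d / 2) p * NCABP.word n (d / 2) q) =
        t.field 1 (NCABP.offset n d + (p * N + q)) := by
    intro p hp q hq
    rw [hF, NCABP.coeff_ofOutput, NCABP.position_eq, FreeMonoid.length_mul,
      NCABP.length_word hp, NCABP.length_word hq, NCABP.wordIndex_mul, NCABP.length_word hq,
      NCABP.wordIndex_word hp, NCABP.wordIndex_word hq, hhalf, if_pos rfl]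
  refine ⟨F, fun hF0 => ?_, fun w hw => ?_, fun w hw => ?_, hC n m d h hn hm hd, fun A hA => ?_⟩
  · have := hpos 0 hN0 (N - 1) (by omega)
    rw [zero_mul, zero_add, r2, hF0] at this
    exact zero_ne_one this
  · by_contra hl
    exact hw (if_neg hl)
  · rw [hF, NCABP.coeff_ofOutput]
    split_ifs with hl
    · rfl
    -- Shorter words have positions below `offset n d`, where the output array is still zero.
    · refine r1 _ ?_
      have h1 := NCABP.wordIndex_lt w
      have h2 := NCABP.offset_mono n (show w.length + 1 ≤ d by omega)
      rw [NCABP.offset_succ] at h2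
      rw [NCABP.position_eq]
      omega
  · set y := (n : ℝ) ^ (ε * (d : ℝ) / 2) / (2 * (m : ℝ) * (d : ℝ) ^ 2) with hy
    have hy0 : 0 ≤ y := by positivity
    set r := ⌊y⌋₊ with hr
    have hfloor : ((⌊y⌋ : ℤ) : ℝ) = (r : ℝ) := by
      rw [hr, natCast_floor_eq_intCast_floor hy0]
    obtain ⟨e1, e2⟩ := NCABP.rpow_estimate (r := r) (δ := δ) hn hm hd heven hε hε1
      (Nat.floor_le hy0) (Nat.floor_le (by positivity))
    have hle : r ≤ A.size := by
      refine NCABP.le_size hd (by omega) (F := F) (h := h)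
        (col := NCABP.outCol N (NCABP.offset n d) t) (fun q hq => ?_) (fun q hq => ?_) hA
      · funext p
        rw [NCABP.outCol, NCABP.wordCoeffs_apply]
        split_ifs with hp
        · rw [NCABP.coeff_rightQuot, hpos p hp q (by omega)]
        · rfl
      -- The bound `8 * r ≤ N` keeps `q` away from the altered column `N - 1`. The room needed is `q
      -- * (δ + 1) + δ < (q + 1) * (δ + 1) ≤ r * (δ + 1) ≤ N`.
      · obtain ⟨V, hV1, hV2, hV3⟩ := r3 q (by omega)
        refine ⟨V, hV1, hV2, hV3 ?_⟩
        have e3 := Nat.mul_le_mul_right (δ + 1) (show q + 1 ≤ r from hq)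
        rw [Nat.add_mul, one_mul] at e3
        omega
    rw [hfloor]
    have hd1 : 1 / ((d : ℝ) + 1) ≤ 1 := by
      rw [div_le_one (by positivity)]
      linarith [(Nat.cast_nonneg d : (0 : ℝ) ≤ d)]
    calc 1 / ((d : ℝ) + 1) * (r : ℝ) ≤ 1 * r := mul_le_mul_of_nonneg_right hd1 (Nat.cast_nonneg r)
      _ = r := one_mul _
      _ ≤ A.size := by exact_mod_cast hle
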